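/- For $\alpha\in(0,2]$, $\sigma>0$, $\beta\in[-1,1]$, $\mu\in\mathbb R$ let $S_\alpha(\sigma,\beta,\mu)$ be the probability law on $\mathbb R$ with characteristic function $\varphi(t)=\exp\big(j\mu t-|\sigma t|^\alpha(1-j\beta\,\mathrm{sign}(t)\,\omega(t,\alpha))\big)$, where $\omega(t,\alpha)=\tan(\pi\alpha/2)$ if $\alpha\ne1$ and $\omega(t,1)=-\frac2\pi\log|t|$. Put $C_\alpha=\frac{1-\alpha}{\Gamma(2-\alpha)\,2\cos(\pi\alpha/2)}$ for $\alpha\in(0,1)$. Let the path-loss exponent be $\delta>2$ and let $\alpha=2/\delta\in(0,1)$. A fusion center is at the origin of the plane. Two independent sensor networks are given. Desired network: the sensor positions $x_1,x_2,\dots$ form a homogeneous Poisson point process (PPP) in $\mathbb R^2$ of density $\lambda_D>0$, and $r_i=|x_i|$. Sensor $i$ has a real channel coefficient $h_i$ with $E[h^2]=1$ and a local error event $e_i$ of probability $P_e<1$. The pairs $(h_i,e_i)$ are i.i.d. and independent of the positions, and $h_i$ is independent of $e_i$. Without local errors the local decisions are $M_i=M$ (with $M>0$ a constant) under $H_1$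 and $M_i=0$ under $H_0$. With local errors, $M_i$ is replaced by $0$ on $e_i$ (an erroneous sensor does not transmit). Interfering network: the node positions form a homogeneous PPP of density $\lambda_I>0$, with distances $\rho_i$ to the fusion center. The triples $(\tilde h_i,g_i,w_i)$ of real random variables (channel to this fusion center, channel to the node's own fusion center, emission) are i.i.d. and independent of the positions. The variable $\tilde h_i$ is symmetric and independent of $(g_i,w_i)$, and $0<E[|\tilde hgw|^\alpha]<\infty$. The interference is $W=\sum_i \tilde h_ig_iw_i/\rho_i^\delta$. The desired signal under $H_1$ is $S=\sum_i h_i^2M/r_i^\delta$ without local errors and $S_e=\sum_i h_i^2M\mathbf 1_{e_i^c}/r_i^\delta$ with local errors. The observation is $Y=\sum_i h_i^2M_i/r_i^\delta+W$, where the $M_i$ are those of the hypothesis and of the case (without or with local errors) considered. Then the series $S$, $S_e$ and $W$ converge absolutely almost surely, and there are $\sigma_S,\sigma_W,\sigma_{S,e}>0$ such that the following hold. 1. $S\sim S_\alpha(\sigma_S,1,0)$ with $\sigma_S^\alpha=\lambda_D\frac\pi2C_\alpha^{-1}M^\alpha E[|h|^{2\alpha}]$. 2. $W\sim S_\alpha(\sigma_W,0,0)$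 with $\sigma_W^\alpha=\lambda_I\frac\pi2C_\alpha^{-1}E[|\tilde hgw|^\alpha]$. 3. Without local errors, $Y=S+W\sim S_\alpha(\sigma_{H_1},\beta_{H_1},0)$ under $H_1$ and $Y=W\sim S_\alpha(\sigma_W,0,0)$ under $H_0$, where $\sigma_{H_1}=(\sigma_S^\alpha+\sigma_W^\alpha)^{1/\alpha}$ and $\beta_{H_1}=\sigma_S^\alpha/(\sigma_S^\alpha+\sigma_W^\alpha)\in(0,1)$. 4. With local errors, the transmitting sensors (those for which $e_i$ does not occur) form a homogeneous PPP of density $\lambda_{D,e}=\lambda_D(1-P_e)$, and $S_e\sim S_\alpha(\sigma_{S,e},1,0)$ with $\sigma_{S,e}^\alpha=\lambda_{D,e}\frac\pi2C_\alpha^{-1}M^\alpha E[|h|^{2\alpha}]$. Moreover $Y=S_e+W$ under $H_1$ and $Y=W$ under $H_0$ have the laws of item 3 with $\sigma_S$ replaced by $\sigma_{S,e}$ everywhere, and again $\beta_{H_1}\in(0,1)$. If $P_e>0$, then $\sigma_{S,e}^\alpha<\sigma_S^\alpha$. -/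

import Mathlib

open MeasureTheory ProbabilityTheory
open scoped ENNReal

namespace CoexistingWSN

/-- The Euclidean plane; the fusion center is at the origin. -/
abbrev Plane : Type := EuclideanSpace ℝ (Fin 2)

/-! ### Stable laws -/

/-- The function `ω(t, α)` in the characteristic function of a stable law. -/
noncomputable def stableOmega (t α : ℝ) : ℝ :=
  if α = 1 then -(2 / Real.pi) * Real.log |t| else Real.tan (Real.pi * α / 2)

/-- The characteristic function of the stable law `S_α(σ, β, μ)`. -/
noncomputable def stableCharFun (α σ β μ t : ℝ) : ℂ :=
  Complex.exp (Complex.I * μ * t -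
    (|σ * t| ^ α : ℝ) * (1 - Complex.I * β * Real.sign t * stableOmega t α))

/-- `IsStableLaw ν α σ β μ`: the probability measure `ν` on the line is the law `S_α(σ, β, μ)`,
with characteristic exponent `α`, scale `σ`, skew `β` and shift `μ` in their admissible ranges. -/
structure IsStableLaw (ν : Measure ℝ) (α σ β μ : ℝ) : Prop where
  exponent_pos : 0 < α
  exponent_le : α ≤ 2
  scale_pos : 0 < σ
  skew_ge : -1 ≤ β
  skew_le : β ≤ 1
  isProbabilityMeasure : IsProbabilityMeasure ν
  charFun_eq : ∀ t : ℝ, charFun ν t = stableCharFun α σ β μ t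

/-- The constant `C_α = (1 - α) / (Γ(2 - α) · 2 · cos (π α / 2))` (for `α ≠ 1`). -/
noncomputable def stableConst (α : ℝ) : ℝ :=
  (1 - α) / (Real.Gamma (2 - α) * 2 * Real.cos (Real.pi * α / 2))

/-! ### Poisson networks -/

/-- The random measure `N` on `E` is a Poisson point process with intensity measure `Λ`:
the number of points in a measurable set `A` with `Λ A < ∞` is Poisson with mean `Λ A`, and the
numbers of points in finitely many disjoint such sets are independent. -/
structure IsPoissonPointProcess {Ω E : Type*} [MeasurableSpace Ω] [MeasurableSpace E]
    (N : Ω → Measure E) (Λ : Measure E) (P : Measure Ω) : Prop where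
  count_law : ∀ A : Set E, MeasurableSet A → Λ A < ∞ →
    P.map (fun ω => N ω A) = (poissonMeasure (Λ A).toNNReal).map (fun k : ℕ => (k : ℝ≥0∞))
  count_indep : ∀ (n : ℕ) (A : Fin n → Set E), (∀ i, MeasurableSet (A i)) →
    (∀ i, Λ (A i) < ∞) → Pairwise (Function.onFun Disjoint A) →
    iIndepFun (fun (i : Fin n) (ω : Ω) => N ω (A i)) P

/-- A homogeneous Poisson point process in the plane with spatial density `lam`. -/
def IsHomogeneousPPP {Ω : Type*} [MeasurableSpace Ω]
    (N : Ω → Measure Plane) (lam : ℝ) (P : Measure Ω) : Prop :=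
  IsPoissonPointProcess N (ENNReal.ofReal lam • (volume : Measure Plane)) P

/-- The point process (counting measure) of all nodes of a network with positions `x i`. -/
noncomputable def nodes {Ω : Type*} (x : ℕ → Ω → Plane) (ω : Ω) : Measure Plane :=
  Measure.sum fun i => Measure.dirac (x i ω)

/-- The point process of those nodes whose local detection is not in error. -/
noncomputable def transmittingNodes {Ω : Type*} (x : ℕ → Ω → Plane) (err : ℕ → Ω → Bool)
    (ω : Ω) : Measure Plane :=
  Measure.sum fun i => if err i ω then 0 else Measure.dirac (x i ω)

/-- A network whose node positions `x i` (in an arbitrary enumeration) form a homogeneous Poisson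
point process of density `lam` and whose nodes carry i.i.d. marks `m i`, independent of the
positions. -/
structure IsMarkedPoissonNetwork {Ω E : Type*} [MeasurableSpace Ω] [MeasurableSpace E]
    (x : ℕ → Ω → Plane) (m : ℕ → Ω → E) (lam : ℝ) (P : Measure Ω) : Prop where
  measurable_position : ∀ i, Measurable (x i)
  measurable_mark : ∀ i, Measurable (m i)
  poisson : IsHomogeneousPPP (nodes x) lam P
  mark_indep : iIndepFun m P
  mark_ident : ∀ i, IdentDistrib (m i) (m 0) P P
  indep : IndepFun (fun ω i => x i ω) (fun ω i => m i ω) P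

/-! ### The received signals -/

/-- The two hypotheses of the detection problem. -/
inductive Hypothesis : Type
  | H0
  | H1

/-- The common value of the error-free local decisions: `M` under `H1` and `0` under `H0`. -/
def decision (M : ℝ) : Hypothesis → ℝ
  | Hypothesis.H0 => 0
  | Hypothesis.H1 => M

/-- The local decision sent by a sensor that may be in error: an erroneous sensor stays silent. -/
def decisionErr (M : ℝ) (k : Hypothesis) (err : Bool) : ℝ :=
  if err then 0 else decision M k

/-- The contribution `a i / r_i ^ δ` of node `i` at the fusion center, `r_i` being its distance. -/
noncomputable def contribution {Ω : Type*} (δ : ℝ) (x : ℕ → Ω → Plane) (a : ℕ → Ω → ℝ)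
    (i : ℕ) (ω : Ω) : ℝ :=
  a i ω / ‖x i ω‖ ^ δ

/-- The aggregate `∑ i, a i / r_i ^ δ` received at the fusion center. -/
noncomputable def aggregate {Ω : Type*} (δ : ℝ) (x : ℕ → Ω → Plane) (a : ℕ → Ω → ℝ) (ω : Ω) : ℝ :=
  ∑' i, contribution δ x a i ω

/-- The emission `h_i² M_i` of the desired sensors under hypothesis `k`, without local errors. -/
def emission {Ω : Type*} (h : ℕ → Ω → ℝ) (M : ℝ) (k : Hypothesis) (i : ℕ) (ω : Ω) : ℝ :=
  h i ω ^ 2 * decision M k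

/-- The emission `h_i² M_i` of the desired sensors under hypothesis `k`, with local errors. -/
def emissionErr {Ω : Type*} (h : ℕ → Ω → ℝ) (err : ℕ → Ω → Bool) (M : ℝ) (k : Hypothesis)
    (i : ℕ) (ω : Ω) : ℝ :=
  h i ω ^ 2 * decisionErr M k (err i ω)

/-- The effective emission `h_i g_i w_i` of the interfering nodes. -/
def interferer {Ω : Type*} (hI g w : ℕ → Ω → ℝ) (i : ℕ) (ω : Ω) : ℝ :=
  hI i ω * g i ω * w i ω

end CoexistingWSN

open CoexistingWSN

/-! Each received signal is a shot noise `∑ a(m i) / ‖x i‖ ^ δ` over a marked Poisson network.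
Campbell's exponential formula gives its characteristic function at `t` as `exp(-∫∫ (1 - exp(i t
a(b) ‖y‖^(-δ))) lam dy ν(db))`, where `ν` is the law of a mark. Under `u = ‖y‖^(-δ)` Lebesgue
measure on the plane becomes `π α u^(-α-1) du` with `α = 2/δ`, the Lévy measure of a one-sided
`α`-stable law. Scaling in `u` extracts `|t a|^α`, and what remains is `Γ(1-α)/α · exp(∓iπα/2)`.
Hence the scale is governed by `E|a|^α` and the skew is `E[sign(a)|a|^α] / E|a|^α`: it is 1 for the
nonnegative desired emissions, and 0 for the interferers because of their independent symmetric
factor.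

Three results carry this. `IsPoissonPointProcess.tendsto_integral_prod` is the generating
functional: for simple functions it follows from independent Poisson counts, and it extends by an
`L¹` bound uniform in the number of points. `IsMarkedPoissonNetwork.integral_exp_tsum` averages over
the marks to reach the exponential formula. `integral_one_sub_exp_I_mul_rpow` evaluates the
oscillatory integral by integration by parts on the positive axis, analytic continuation to the
right half-plane and passage to the imaginary axis.

A silent sensor emits 0, so local errors multiply `E|a|^α` by `1 - P_e`. The thinned point process
is obtained separately: the exponential formula applied to indicators shows that the marked points
are Poisson on the product space. Under `H1` independence of the networks multiplies the
characteristic functions. -/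

namespace CoexistingWSN

open Filter Topology
open scoped NNReal

/-! ### Generating function and mean of the Poisson law. -/

section PoissonMeasure

/-- The probability generating function of the Poisson law. -/
theorem integral_pow_poissonMeasure (r : ℝ≥0) (z : ℂ) :
    ∫ k : ℕ, z ^ k ∂(poissonMeasure r) = Complex.exp (r * (z - 1)) := by
  rw [integral_poissonMeasure]
  calc ∑' n : ℕ, (Real.exp (-r) * r ^ n / (n.factorial : ℝ)) • z ^ n
      = ∑' n : ℕ, (Real.exp (-r) : ℂ) * ((r * z) ^ n / (n.factorial : ℂ)) := by
        congr with n
        rw [Complex.real_smul]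
        push_cast
        rw [mul_pow]
        ring
    _ = (Real.exp (-r) : ℂ) * Complex.exp (r * z) := by
        rw [tsum_mul_left, (NormedSpace.expSeries_div_hasSum_exp (r * z : ℂ)).tsum_eq,
          Complex.exp_eq_exp_ℂ]
    _ = Complex.exp (r * (z - 1)) := by
        rw [Complex.ofReal_exp, ← Complex.exp_add]
        push_cast
        ring_nf

/-- The mean of the Poisson law. -/
theorem lintegral_natCast_poissonMeasure (r : ℝ≥0) :
    ∫⁻ k : ℕ, (k : ℝ≥0∞) ∂(poissonMeasure r) = r := by
  have hs : HasSum (fun n : ℕ => Real.exp (-r) * r ^ n / (n.factorial : ℝ) * n) (r : ℝ) := by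
    -- The term at 0 vanishes and `n / n! = 1 / (n-1)!`, so the shifted series is `r` times the
    -- total mass.
    rw [hasSum_nat_add_iff' 1 |>.symm]
    have h := (hasSum_one_poissonMeasure r).mul_left (r : ℝ)
    simp only [Finset.range_one, Finset.sum_singleton, Nat.cast_zero, mul_zero, sub_zero]
    rw [mul_one] at h
    refine h.congr_fun ?_
    intro n
    rw [Nat.factorial_succ]
    have : (n.factorial : ℝ) ≠ 0 := by positivity
    push_cast
    field_simp
    ring
  rw [poissonMeasure, lintegral_sum_measure]
  simp only [lintegral_smul_measure, lintegral_dirac, smul_eq_mul]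
  have : ∀ n : ℕ, ENNReal.ofReal (Real.exp (-r) * r ^ n / (n.factorial : ℝ)) * (n : ℝ≥0∞)
      = ENNReal.ofReal (Real.exp (-r) * r ^ n / (n.factorial : ℝ) * n) := by
    intro n
    rw [ENNReal.ofReal_mul (by positivity), ENNReal.ofReal_natCast]
  simp_rw [this]
  rw [← ENNReal.ofReal_tsum_of_nonneg (fun n => by positivity) hs.summable, hs.tsum_eq,
    ENNReal.ofReal_coe_nnreal]

end PoissonMeasure

/-! ### Generating functional of a Poisson point process. -/

section PointProcess

variable {Ω E : Type*} [MeasurableSpace E]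

/-- The counting measure of the points `x i`. -/
noncomputable def pointProcess (x : ℕ → Ω → E) (ω : Ω) : Measure E :=
  Measure.sum fun i => Measure.dirac (x i ω)

theorem pointProcess_apply (x : ℕ → Ω → E) (ω : Ω) {A : Set E} (hA : MeasurableSet A) :
    pointProcess x ω A = ∑' i, A.indicator 1 (x i ω) := by
  rw [pointProcess, Measure.sum_apply _ hA]
  congr with i
  rw [Measure.dirac_apply' _ hA]

/-- The number of points in a set, as a natural number. -/
noncomputable def countNat (e : ℝ≥0∞) : ℕ := ⌊e.toReal⌋₊

theorem countNat_natCast (k : ℕ) : countNat k = k := by simp [countNat]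

theorem measurable_countNat : Measurable countNat :=
  Nat.measurable_floor.comp ENNReal.measurable_toReal

theorem finite_setOf_mem_of_pointProcess_lt_top {x : ℕ → Ω → E} {ω : Ω} {A : Set E} (hA : MeasurableSet A)
    (h : pointProcess x ω A < ∞) : {i | x i ω ∈ A}.Finite := by
  rw [pointProcess_apply x ω hA] at h
  have := ENNReal.finite_const_le_of_tsum_ne_top h.ne one_ne_zero
  refine this.subset fun i hi => ?_
  simp [Set.indicator_of_mem (show x i ω ∈ A from hi)]

theorem countNat_pointProcess {x : ℕ → Ω → E} {ω : Ω} {A : Set E} (hA : MeasurableSet A)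
    (h : {i | x i ω ∈ A}.Finite) : countNat (pointProcess x ω A) = h.toFinset.card := by
  have h1 : pointProcess x ω A = (h.toFinset.card : ℝ≥0∞) := by
    rw [pointProcess_apply x ω hA, tsum_eq_sum (s := h.toFinset) fun i hi =>
      Set.indicator_of_notMem (by simpa using hi) _]
    have : ∀ i ∈ h.toFinset, A.indicator 1 (x i ω) = (1 : ℝ≥0∞) := fun i hi =>
      Set.indicator_of_mem (by simpa using hi) _
    rw [Finset.sum_congr rfl this]
    simp
  rw [h1, countNat_natCast]

variable [MeasurableSpace Ω]

theorem measurable_pointProcess_apply {x : ℕ → Ω → E} (hx : ∀ i, Measurable (x i))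
    {A : Set E} (hA : MeasurableSet A) : Measurable fun ω => pointProcess x ω A := by
  simp_rw [pointProcess_apply x _ hA]
  exact Measurable.tsum fun i => (measurable_one.indicator hA).comp (hx i)

variable {P : Measure Ω} {x : ℕ → Ω → E} {Λ : Measure E}

theorem lintegral_pointProcess_apply (hx : ∀ i, Measurable (x i))
    {A : Set E} (hA : MeasurableSet A) :
    ∫⁻ ω, pointProcess x ω A ∂P = Measure.sum (fun i => P.map (x i)) A := by
  simp_rw [pointProcess_apply x _ hA]
  rw [lintegral_tsum (f := fun i ω => A.indicator 1 (x i ω))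
    fun i => ((measurable_one.indicator hA).comp (hx i)).aemeasurable, Measure.sum_apply _ hA]
  congr with i
  rw [Measure.map_apply (hx i) hA, ← lintegral_indicator_one ((hx i) hA)]
  rfl

theorem IsPoissonPointProcess.lintegral_apply (hx : ∀ i, Measurable (x i))
    (hN : IsPoissonPointProcess (pointProcess x) Λ P) {A : Set E} (hA : MeasurableSet A)
    (hΛ : Λ A < ∞) : ∫⁻ ω, pointProcess x ω A ∂P = Λ A := by
  have h := lintegral_map (μ := P) (f := id) measurable_id (measurable_pointProcess_apply hx hA)
  simp only [id] at h
  rw [← h, hN.count_law A hA hΛ, lintegral_map (f := fun e => e) measurable_id .of_discrete,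
    lintegral_natCast_poissonMeasure, ENNReal.coe_toNNReal hΛ.ne]

/-- The intensity measure of a Poisson point process is the sum of the laws of its points. -/
theorem IsPoissonPointProcess.sum_map_eq [SigmaFinite Λ] (hx : ∀ i, Measurable (x i))
    (hN : IsPoissonPointProcess (pointProcess x) Λ P) :
    Measure.sum (fun i => P.map (x i)) = Λ := by
  -- Counts are only controlled on sets of finite intensity, hence the exhaustion by spanning sets.
  refine (Measure.ext_iff_of_iUnion_eq_univ (iUnion_spanningSets Λ)).2 fun n => ?_
  ext A hA
  have hm := hA.inter (measurableSet_spanningSets Λ n)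
  rw [Measure.restrict_apply hA, Measure.restrict_apply hA,
    ← lintegral_pointProcess_apply hx hm, hN.lintegral_apply hx hm]
  exact (measure_mono Set.inter_subset_right).trans_lt (measure_spanningSets_lt_top Λ n)

/-- Swap one factor at a time; all the others have norm at most 1. The absence of a constant
depending on `s` is what later makes approximation uniform in the number of points. -/
theorem norm_prod_sub_prod_le {ι : Type*} (s : Finset ι) (a b : ι → ℂ) (ha : ∀ i, ‖a i‖ ≤ 1)
    (hb : ∀ i, ‖b i‖ ≤ 1) : ‖∏ i ∈ s, a i - ∏ i ∈ s, b i‖ ≤ ∑ i ∈ s, ‖a i - b i‖ := by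
  classical
  induction s using Finset.induction with
  | empty => simp
  | insert i s hi ih =>
    rw [Finset.prod_insert hi, Finset.prod_insert hi, Finset.sum_insert hi]
    have h1 : ‖∏ j ∈ s, b j‖ ≤ 1 := by
      rw [norm_prod]
      exact Finset.prod_le_one (fun _ _ => norm_nonneg _) fun j _ => hb j
    calc ‖a i * ∏ j ∈ s, a j - b i * ∏ j ∈ s, b j‖
        = ‖a i * (∏ j ∈ s, a j - ∏ j ∈ s, b j) + (a i - b i) * ∏ j ∈ s, b j‖ := by ring_nf
      _ ≤ ‖a i‖ * ‖∏ j ∈ s, a j - ∏ j ∈ s, b j‖ + ‖a i - b i‖ * ‖∏ j ∈ s, b j‖ := by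
          rw [← norm_mul, ← norm_mul]
          exact norm_add_le _ _
      _ ≤ 1 * ‖∏ j ∈ s, a j - ∏ j ∈ s, b j‖ + ‖a i - b i‖ * 1 := by
          gcongr
          exact ha i
      _ ≤ _ := by linarith

theorem integral_pow_countNat (hx : ∀ i, Measurable (x i))
    (hN : IsPoissonPointProcess (pointProcess x) Λ P) {A : Set E} (hA : MeasurableSet A)
    (hΛ : Λ A < ∞) (z : ℂ) :
    ∫ ω, z ^ countNat (pointProcess x ω A) ∂P = Complex.exp (Λ.real A * (z - 1)) := by
  have hz : Measurable fun e : ℝ≥0∞ => z ^ countNat e :=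
    (Measurable.of_discrete (f := fun k : ℕ => z ^ k)).comp measurable_countNat
  have h := integral_map (μ := P) (measurable_pointProcess_apply hx hA).aemeasurable
    (f := fun e : ℝ≥0∞ => z ^ countNat e) hz.aestronglyMeasurable
  rw [← h, hN.count_law A hA hΛ, integral_map Measurable.of_discrete.aemeasurable
    hz.aestronglyMeasurable]
  simp_rw [countNat_natCast]
  rw [integral_pow_poissonMeasure]
  rfl

variable [IsProbabilityMeasure P]

/-- The generating functional of a Poisson point process at a simple function. -/
theorem IsPoissonPointProcess.tendsto_integral_prod_simpleFunc [SigmaFinite Λ]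
    (hx : ∀ i, Measurable (x i))
    (hN : IsPoissonPointProcess (pointProcess x) Λ P) (g : SimpleFunc E ℂ)
    (hg : Integrable g Λ) (hg1 : ∀ a, ‖1 - g a‖ ≤ 1) :
    Tendsto (fun n => ∫ ω, ∏ i ∈ Finset.range n, (1 - g (x i ω)) ∂P) atTop
      (𝓝 (Complex.exp (-∫ a, g a ∂Λ))) := by
  classical
  -- Level sets of nonzero values have finite intensity because `g` is integrable; the level 0
  -- contributes only factors 1.
  set K : Finset ℂ := g.range.filter (· ≠ 0) with hK
  have hKm : ∀ c, MeasurableSet (g ⁻¹' {c}) := fun c => g.measurableSet_fiber c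
  have hKf : ∀ c ∈ K, Λ (g ⁻¹' {c}) < ∞ := fun c hc =>
    SimpleFunc.integrable_iff.1 hg c (Finset.mem_filter.1 hc).2
  have hfin : ∀ᵐ ω ∂P, ∀ c ∈ K, pointProcess x ω (g ⁻¹' {c}) < ∞ := by
    rw [Finset.eventually_all]
    intro c hc
    refine ae_lt_top (measurable_pointProcess_apply hx (hKm c)) ?_
    rw [hN.lintegral_apply hx (hKm c) (hKf c hc)]
    exact (hKf c hc).ne
  have hval : Complex.exp (-∫ a, g a ∂Λ) =
      ∫ ω, ∏ c ∈ K, (1 - c) ^ countNat (pointProcess x ω (g ⁻¹' {c})) ∂P := by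
    let e := K.equivFin
    have hind := hN.count_indep K.card (fun i => g ⁻¹' {(e.symm i : ℂ)}) (fun i => hKm _)
      (fun i => hKf _ (e.symm i).2) (by
        intro i j hij
        refine Set.disjoint_left.2 fun a hi hj => hij ?_
        have : (e.symm i : ℂ) = e.symm j := by
          rw [← show g a = _ from hi, ← show g a = _ from hj]
        exact e.symm.injective (Subtype.ext this))
    have h1 : ∀ ω, ∏ c ∈ K, (1 - c) ^ countNat (pointProcess x ω (g ⁻¹' {c})) =
        ∏ i, (1 - (e.symm i : ℂ)) ^ countNat (pointProcess x ω (g ⁻¹' {(e.symm i : ℂ)})) := by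
      intro ω
      rw [← Finset.prod_coe_sort]
      exact (Equiv.prod_comp e.symm
        (fun c : K => (1 - (c : ℂ)) ^ countNat (pointProcess x ω (g ⁻¹' {(c : ℂ)})))).symm
    simp_rw [h1]
    rw [hind.integral_fun_prod_comp (f := fun i u => (1 - (e.symm i : ℂ)) ^ countNat u)
      (fun i => (measurable_pointProcess_apply hx (hKm _)).aemeasurable)
      (fun i => ((Measurable.of_discrete (f := fun k : ℕ => (1 - (e.symm i : ℂ)) ^ k)).comp
        measurable_countNat).aestronglyMeasurable)]
    simp_rw [fun i => integral_pow_countNat hx hN (hKm (e.symm i)) (hKf _ (e.symm i).2)]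
    rw [Equiv.prod_comp e.symm
      (fun c : K => Complex.exp (Λ.real (g ⁻¹' {(c : ℂ)}) * (1 - (c : ℂ) - 1))),
      Finset.prod_coe_sort K (fun c => Complex.exp (Λ.real (g ⁻¹' {c}) * (1 - c - 1))),
      ← Complex.exp_sum]
    congr 1
    have h2 : ∫ a, g a ∂Λ = ∑ c ∈ K, Λ.real (g ⁻¹' {c}) • c := by
      rw [← SimpleFunc.integral_eq_integral _ hg, SimpleFunc.integral_eq_sum_filter]
    rw [h2, ← Finset.sum_neg_distrib]
    refine Finset.sum_congr rfl fun c _ => ?_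
    rw [Complex.real_smul]
    ring
  rw [hval]
  refine tendsto_integral_of_dominated_convergence (fun _ => 1) (fun n => ?_)
    (integrable_const 1) (fun n => ?_) ?_
  · exact (Finset.measurable_prod _ fun i _ =>
      measurable_const.sub (g.measurable.comp (hx i))).aestronglyMeasurable
  · refine ae_of_all _ fun ω => ?_
    rw [norm_prod]
    exact Finset.prod_le_one (fun _ _ => norm_nonneg _) fun i _ => hg1 _
  · filter_upwards [hfin] with ω hω
    have hf : ∀ c ∈ K, {i | x i ω ∈ g ⁻¹' {c}}.Finite := fun c hc =>
      finite_setOf_mem_of_pointProcess_lt_top (hKm c) (hω c hc)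
    -- Almost surely only finitely many points see a nonzero value, so the partial products are
    -- eventually constant. Grouping the factors by the value of `g` turns them into powers given by
    -- the counts.
    have hT : {i | g (x i ω) ≠ 0}.Finite := by
      refine (K.finite_toSet.biUnion hf).subset fun i hi => ?_
      refine Set.mem_biUnion (x := g (x i ω)) ?_ rfl
      exact Finset.mem_coe.2 (Finset.mem_filter.2 ⟨g.mem_range_self _, hi⟩)
    refine tendsto_const_nhds.congr' ?_
    obtain ⟨m, hm⟩ := hT.bddAbove
    filter_upwards [eventually_gt_atTop m] with n hn
    have hsub : hT.toFinset ⊆ Finset.range n := fun i hi =>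
      Finset.mem_range.2 ((hm (hT.mem_toFinset.1 hi)).trans_lt hn)
    rw [← Finset.prod_subset hsub (fun i _ hi => by
      have : g (x i ω) = 0 := by simpa using hi
      simp [this])]
    rw [← Finset.prod_fiberwise_of_maps_to (t := K) (g := fun i => g (x i ω)) (fun i hi =>
      Finset.mem_filter.2 ⟨g.mem_range_self _, hT.mem_toFinset.1 hi⟩)]
    refine Finset.prod_congr rfl fun c hc => ?_
    rw [countNat_pointProcess (hKm c) (hf c hc), Finset.prod_congr rfl (g := fun _ => 1 - c)
      (fun i hi => by rw [(Finset.mem_filter.1 hi).2]), Finset.prod_const]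
    congr 2
    ext i
    simp only [Set.Finite.mem_toFinset, Set.mem_ofPred_eq, Set.mem_preimage,
      Set.mem_singleton_iff, Finset.mem_filter]
    refine ⟨fun h => ⟨?_, h⟩, fun h => h.2⟩
    rw [h]
    exact (Finset.mem_filter.1 hc).2

/-- The generating functional of a Poisson point process. -/
theorem IsPoissonPointProcess.tendsto_integral_prod [SigmaFinite Λ]
    (hx : ∀ i, Measurable (x i))
    (hN : IsPoissonPointProcess (pointProcess x) Λ P) {g : E → ℂ} (hgm : Measurable g)
    (hg : Integrable g Λ) (hg1 : ∀ a, ‖1 - g a‖ ≤ 1) :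
    Tendsto (fun n => ∫ ω, ∏ i ∈ Finset.range n, (1 - g (x i ω)) ∂P) atTop
      (𝓝 (Complex.exp (-∫ a, g a ∂Λ))) := by
  have h0 : (0 : ℂ) ∈ Metric.closedBall (1 : ℂ) 1 := by simp
  have hball : ∀ z : ℂ, z ∈ Metric.closedBall (1 : ℂ) 1 ↔ ‖1 - z‖ ≤ 1 := by
    intro z
    rw [mem_closedBall_iff_norm, norm_sub_rev]
  -- Approximating inside the closed ball around 1 keeps every factor `1 - G m` of norm at most 1.
  let G : ℕ → SimpleFunc E ℂ := SimpleFunc.approxOn g hgm (Metric.closedBall (1 : ℂ) 1) 0 h0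
  have hG1 : ∀ m a, ‖1 - G m a‖ ≤ 1 := fun m a =>
    (hball _).1 (SimpleFunc.approxOn_mem hgm h0 m a)
  have hGi : ∀ m, Integrable (G m) Λ := fun m =>
    SimpleFunc.integrable_approxOn hgm hg h0 (integrable_zero _ _ _) m
  have hGt : Tendsto (fun m => ∫⁻ a, ‖G m a - g a‖ₑ ∂Λ) atTop (𝓝 0) := by
    refine SimpleFunc.tendsto_approxOn_L1_enorm hgm h0
      (ae_of_all _ fun a => subset_closure ((hball _).2 (hg1 a))) ?_
    simpa using hg.2
  -- The laws of the points sum to `Λ`, so the error of the first `n` factors is at most the `L¹(Λ)`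
  -- distance, whatever `n` is. This uniformity allows the limits in `m` and `n` to be exchanged.
  have hbound : ∀ (m n : ℕ),
      ‖(∫ ω, ∏ i ∈ Finset.range n, (1 - g (x i ω)) ∂P) -
        ∫ ω, ∏ i ∈ Finset.range n, (1 - G m (x i ω)) ∂P‖ₑ ≤ ∫⁻ a, ‖G m a - g a‖ₑ ∂Λ := by
    intro m n
    have hint : ∀ {f : E → ℂ}, Measurable f → (∀ a, ‖1 - f a‖ ≤ 1) →
        Integrable (fun ω => ∏ i ∈ Finset.range n, (1 - f (x i ω))) P := by
      intro f hf hf1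
      refine Integrable.of_bound (C := 1) (Finset.measurable_prod _ fun i _ =>
        measurable_const.sub (hf.comp (hx i))).aestronglyMeasurable (ae_of_all _ fun ω => ?_)
      rw [norm_prod]
      exact Finset.prod_le_one (fun _ _ => norm_nonneg _) fun i _ => hf1 _
    have hm : Measurable fun a => ‖G m a - g a‖ₑ := ((G m).measurable.sub hgm).enorm
    rw [← integral_sub (hint hgm hg1) (hint (G m).measurable (hG1 m))]
    refine (enorm_integral_le_lintegral_enorm _).trans ?_
    calc ∫⁻ ω, ‖∏ i ∈ Finset.range n, (1 - g (x i ω)) -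
            ∏ i ∈ Finset.range n, (1 - G m (x i ω))‖ₑ ∂P
        ≤ ∫⁻ ω, ∑ i ∈ Finset.range n, ‖G m (x i ω) - g (x i ω)‖ₑ ∂P := by
          refine lintegral_mono fun ω => ?_
          have h := norm_prod_sub_prod_le (Finset.range n) (fun i => 1 - g (x i ω))
            (fun i => 1 - G m (x i ω)) (fun i => hg1 _) (fun i => hG1 m _)
          simp only [sub_sub_sub_cancel_left] at h
          rw [← ofReal_norm]
          refine (ENNReal.ofReal_le_ofReal h).trans ?_
          rw [ENNReal.ofReal_sum_of_nonneg fun _ _ => norm_nonneg _]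
          simp_rw [ofReal_norm]
          exact le_rfl
      _ = ∑ i ∈ Finset.range n, ∫⁻ a, ‖G m a - g a‖ₑ ∂(P.map (x i)) := by
          rw [lintegral_finsetSum' (f := fun i ω => ‖G m (x i ω) - g (x i ω)‖ₑ) _ fun i _ => (hm.comp (hx i)).aemeasurable]
          refine Finset.sum_congr rfl fun i _ => ?_
          rw [lintegral_map hm (hx i)]
      _ ≤ ∑' i, ∫⁻ a, ‖G m a - g a‖ₑ ∂(P.map (x i)) := ENNReal.sum_le_tsum _
      _ = ∫⁻ a, ‖G m a - g a‖ₑ ∂Λ := by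
          rw [← lintegral_sum_measure, hN.sum_map_eq hx]
  have hunif : TendstoUniformly
      (fun m n => ∫ ω, ∏ i ∈ Finset.range n, (1 - G m (x i ω)) ∂P)
      (fun n => ∫ ω, ∏ i ∈ Finset.range n, (1 - g (x i ω)) ∂P) atTop := by
    rw [EMetric.tendstoUniformly_iff]
    intro ε hε
    filter_upwards [hGt.eventually_lt_const hε] with m hm n
    rw [edist_eq_enorm_sub]
    exact (hbound m n).trans_lt hm
  have hlim : Tendsto (fun m => Complex.exp (-∫ a, G m a ∂Λ)) atTop
      (𝓝 (Complex.exp (-∫ a, g a ∂Λ))) :=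
    (Complex.continuous_exp.tendsto _).comp (tendsto_integral_of_L1 g hgm.aestronglyMeasurable
      (Eventually.of_forall hGi) hGt).neg
  exact hunif.tendsto_of_eventually_tendsto (Eventually.of_forall fun m =>
    hN.tendsto_integral_prod_simpleFunc hx (G m) (hGi m) (hG1 m)) hlim

end PointProcess

end CoexistingWSN

namespace CoexistingWSN

open Filter Topology
open scoped NNReal

/-! ### Marked networks: Campbell's formula and the exponential formula. -/

section MarkedNetwork

/-- The intensity measure of a homogeneous point process in the plane. -/
noncomputable def intensity (lam : ℝ) : Measure Plane := ENNReal.ofReal lam • volume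

instance (lam : ℝ) : SigmaFinite (intensity lam) := by
  unfold intensity
  exact (inferInstance : SigmaFinite (lam.toNNReal • (volume : Measure Plane)))

variable {Ω M : Type*} [MeasurableSpace Ω] [MeasurableSpace M] {P : Measure Ω}
  {x : ℕ → Ω → Plane} {m : ℕ → Ω → M} {lam : ℝ}

theorem IsMarkedPoissonNetwork.map_mark (net : IsMarkedPoissonNetwork x m lam P) (i : ℕ) :
    P.map (m i) = P.map (m 0) := (net.mark_ident i).map_eq

theorem IsMarkedPoissonNetwork.sum_map_eq (net : IsMarkedPoissonNetwork x m lam P) :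
    Measure.sum (fun i => P.map (x i)) = intensity lam :=
  IsPoissonPointProcess.sum_map_eq net.measurable_position net.poisson

variable [IsProbabilityMeasure P]

theorem IsMarkedPoissonNetwork.isProbabilityMeasure_map_mark
    (net : IsMarkedPoissonNetwork x m lam P) : IsProbabilityMeasure (P.map (m 0)) :=
  Measure.isProbabilityMeasure_map (net.measurable_mark 0).aemeasurable

/-- Campbell's formula for the sum over the points of a marked Poisson network. -/
theorem IsMarkedPoissonNetwork.lintegral_tsum (net : IsMarkedPoissonNetwork x m lam P)
    {f : Plane × M → ℝ≥0∞} (hf : Measurable f) :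
    ∫⁻ ω, ∑' i, f (x i ω, m i ω) ∂P = ∫⁻ p, f p ∂((intensity lam).prod (P.map (m 0))) := by
  have := net.isProbabilityMeasure_map_mark
  have hxm : ∀ i, Measurable fun ω => (x i ω, m i ω) := fun i =>
    (net.measurable_position i).prodMk (net.measurable_mark i)
  rw [MeasureTheory.lintegral_tsum (f := fun i ω => f (x i ω, m i ω))
    fun i => (hf.comp (hxm i)).aemeasurable, lintegral_prod _ hf.aemeasurable,
    ← net.sum_map_eq, lintegral_sum_measure]
  congr with i
  have hind : IndepFun (x i) (m i) P :=
    net.indep.comp (measurable_pi_apply i) (measurable_pi_apply i)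
  rw [← lintegral_map hf (hxm i), (indepFun_iff_map_prod_eq_prod_map_map
    (net.measurable_position i).aemeasurable (net.measurable_mark i).aemeasurable).1 hind,
    net.map_mark i, lintegral_prod _ hf.aemeasurable]

/-- Averaging a product over the points of a marked network with respect to the marks. -/
theorem IsMarkedPoissonNetwork.integral_prod (net : IsMarkedPoissonNetwork x m lam P)
    {F : Plane × M → ℂ} (hF : Measurable F) (hF1 : ∀ p, ‖F p‖ ≤ 1) (n : ℕ) :
    ∫ ω, ∏ i ∈ Finset.range n, F (x i ω, m i ω) ∂P =
      ∫ ω, ∏ i ∈ Finset.range n, ∫ b, F (x i ω, b) ∂(P.map (m 0)) ∂P := by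
  have := net.isProbabilityMeasure_map_mark
  have hX : Measurable fun ω i => x i ω := measurable_pi_lambda _ net.measurable_position
  have hM : Measurable fun ω i => m i ω := measurable_pi_lambda _ net.measurable_mark
  have := Measure.isProbabilityMeasure_map (μ := P) hX.aemeasurable
  have := Measure.isProbabilityMeasure_map (μ := P) hM.aemeasurable
  let Φ : (ℕ → Plane) × (ℕ → M) → ℂ := fun q => ∏ i ∈ Finset.range n, F (q.1 i, q.2 i)
  have hΦ : Measurable Φ := Finset.measurable_prod _ fun i _ => hF.comp
    (((measurable_pi_apply i).comp measurable_fst).prodMk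
      ((measurable_pi_apply i).comp measurable_snd))
  have hΨ : Measurable fun a => ∫ b, F (a, b) ∂(P.map (m 0)) :=
    hF.stronglyMeasurable.integral_prod_right'.measurable
  have hΦ1 : ∀ q, ‖Φ q‖ ≤ 1 := fun q => by
    rw [norm_prod]
    exact Finset.prod_le_one (fun _ _ => norm_nonneg _) fun i _ => hF1 _
  -- With the positions frozen the marks are i.i.d., so the mean of the product factorizes.
  have hinner : ∀ xs : ℕ → Plane, ∫ ms, Φ (xs, ms) ∂(P.map fun ω i => m i ω) =
      ∏ i ∈ Finset.range n, ∫ b, F (xs i, b) ∂(P.map (m 0)) := by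
    intro xs
    rw [integral_map hM.aemeasurable (f := fun ms => Φ (xs, ms))
      (hΦ.comp (measurable_const.prodMk measurable_id)).aestronglyMeasurable]
    have hFi : ∀ i, Measurable fun b => F (xs i, b) := fun i =>
      hF.comp (measurable_const.prodMk measurable_id)
    have hind : iIndepFun (fun (i : Fin n) => m i) P := net.mark_indep.precomp Fin.val_injective
    have h := hind.integral_fun_prod_comp (X := fun (i : Fin n) => m i) (f := fun (i : Fin n) b => F (xs i, b))
      (fun i => (net.measurable_mark i).aemeasurable) (fun i => (hFi i).aestronglyMeasurable)
    rw [Finset.prod_range, ← Finset.prod_congr rfl fun i _ => ?_]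
    · simp only [Φ, Finset.prod_range]
      exact h
    · rw [← net.map_mark i, integral_map (net.measurable_mark i).aemeasurable
        (hFi i).aestronglyMeasurable]
  calc ∫ ω, ∏ i ∈ Finset.range n, F (x i ω, m i ω) ∂P
      = ∫ q, Φ q ∂(P.map fun ω => (fun i => x i ω, fun i => m i ω)) :=
        (integral_map (hX.prodMk hM).aemeasurable hΦ.aestronglyMeasurable).symm
    _ = ∫ xs, ∫ ms, Φ (xs, ms) ∂(P.map fun ω i => m i ω) ∂(P.map fun ω i => x i ω) := by
        rw [(indepFun_iff_map_prod_eq_prod_map_map hX.aemeasurable hM.aemeasurable).1 net.indep,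
          MeasureTheory.integral_prod]
        exact Integrable.of_bound hΦ.aestronglyMeasurable 1 (ae_of_all _ hΦ1)
    _ = _ := by
        simp_rw [hinner]
        rw [integral_map hX.aemeasurable
          (f := fun xs => ∏ i ∈ Finset.range n, ∫ b, F (xs i, b) ∂(P.map (m 0))) (Finset.measurable_prod _ fun i _ =>
          hΨ.comp (measurable_pi_apply i)).aestronglyMeasurable]

/-- The truncated terms tend to 0, so the truncation is eventually inactive. Truncating is necessary
because the path gain is not integrable near the origin. -/
theorem summable_of_summable_min_one {u : ℕ → ℝ} (h : Summable fun i => min |u i| 1) :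
    Summable u := by
  have hev : ∀ᶠ i in atTop, |u i| = min |u i| 1 := by
    filter_upwards [h.tendsto_atTop_zero.eventually_lt_const one_pos] with i hi
    rcases min_lt_iff.1 hi with h | h
    · exact (min_eq_left h.le).symm
    · exact absurd h (lt_irrefl _)
  refine Summable.of_norm ?_
  rw [← Nat.cofinite_eq_atTop] at hev
  exact (summable_congr_cofinite hev).2 h

/-- A sum over the points of a marked Poisson network converges absolutely, almost surely. -/
theorem IsMarkedPoissonNetwork.ae_summable (net : IsMarkedPoissonNetwork x m lam P)
    {f : Plane × M → ℝ} (hf : Measurable f)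
    (hfi : Integrable (fun p => min |f p| 1) ((intensity lam).prod (P.map (m 0)))) :
    ∀ᵐ ω ∂P, Summable fun i => f (x i ω, m i ω) := by
  have hxm : ∀ i, Measurable fun ω => (x i ω, m i ω) := fun i =>
    (net.measurable_position i).prodMk (net.measurable_mark i)
  have hg : Measurable fun p => ENNReal.ofReal (min |f p| 1) :=
    ((measurable_abs.comp hf).min measurable_const).ennreal_ofReal
  have hlt : ∫⁻ ω, ∑' i, ENNReal.ofReal (min |f (x i ω, m i ω)| 1) ∂P ≠ ∞ := by
    rw [net.lintegral_tsum hg]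
    exact (hasFiniteIntegral_iff_ofReal (ae_of_all _ fun p =>
      le_min (abs_nonneg _) zero_le_one)).1 hfi.2 |>.ne
  filter_upwards [ae_lt_top (Measurable.tsum fun i => hg.comp (hxm i)) hlt] with ω hω
  refine summable_of_summable_min_one ?_
  have := ENNReal.summable_toReal hω.ne
  refine this.congr fun i => ?_
  exact ENNReal.toReal_ofReal (le_min (abs_nonneg _) zero_le_one)

theorem norm_one_sub_exp_I_mul_le (u : ℝ) : ‖1 - Complex.exp (Complex.I * u)‖ ≤ 2 * min |u| 1 := by
  rw [norm_sub_rev]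
  have h1 : ‖Complex.exp (Complex.I * u) - 1‖ ≤ |u| := Real.norm_exp_I_mul_ofReal_sub_one_le
  have h2 : ‖Complex.exp (Complex.I * u) - 1‖ ≤ 2 := by
    refine (norm_sub_le _ _).trans ?_
    rw [mul_comm, Complex.norm_exp_ofReal_mul_I]
    norm_num
  rcases min_choice |u| 1 with h | h <;> rw [h]
  · linarith [abs_nonneg u]
  · linarith

theorem integrable_one_sub_exp {X : Type*} [MeasurableSpace X] {μ : Measure X} {f : X → ℝ}
    (hf : Measurable f) (hfi : Integrable (fun p => min |f p| 1) μ) :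
    Integrable (fun p => 1 - Complex.exp (Complex.I * f p)) μ := by
  refine (hfi.const_mul 2).mono' ?_ (ae_of_all _ fun p => norm_one_sub_exp_I_mul_le _)
  exact Measurable.aestronglyMeasurable (by fun_prop)

/-- The characteristic functional of a marked Poisson network. -/
theorem IsMarkedPoissonNetwork.integral_exp_tsum (net : IsMarkedPoissonNetwork x m lam P)
    {f : Plane × M → ℝ} (hf : Measurable f)
    (hfi : Integrable (fun p => min |f p| 1) ((intensity lam).prod (P.map (m 0)))) :
    ∫ ω, Complex.exp (Complex.I * (∑' i, f (x i ω, m i ω) : ℝ)) ∂P =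
      Complex.exp (-∫ p, (1 - Complex.exp (Complex.I * f p))
        ∂((intensity lam).prod (P.map (m 0)))) := by
  have := net.isProbabilityMeasure_map_mark
  have hxm : ∀ i, Measurable fun ω => (x i ω, m i ω) := fun i =>
    (net.measurable_position i).prodMk (net.measurable_mark i)
  let F : Plane × M → ℂ := fun p => Complex.exp (Complex.I * f p)
  have hF : Measurable F := by fun_prop
  have hF1 : ∀ p, ‖F p‖ ≤ 1 := fun p => by
    simp only [F]
    rw [mul_comm, Complex.norm_exp_ofReal_mul_I]
  have hFi := integrable_one_sub_exp hf hfi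
  have hFm : ∀ a, Integrable (fun b => F (a, b)) (P.map (m 0)) := fun a =>
    Integrable.of_bound (hF.comp (measurable_const.prodMk measurable_id)).aestronglyMeasurable 1
      (ae_of_all _ fun b => hF1 _)
  -- Averaging over the mark of each point leaves the factor `1 - g` at its position, to which the
  -- generating functional of the unmarked process applies.
  let g : Plane → ℂ := fun a => ∫ b, (1 - F (a, b)) ∂(P.map (m 0))
  have hg : ∀ a, 1 - g a = ∫ b, F (a, b) ∂(P.map (m 0)) := by
    intro a
    simp only [g]
    rw [integral_sub (integrable_const _) (hFm a)]
    simp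
  have hgm : Measurable g :=
    (measurable_const.sub hF).stronglyMeasurable.integral_prod_right'.measurable
  have hgen := IsPoissonPointProcess.tendsto_integral_prod (Λ := intensity lam) net.measurable_position net.poisson
    hgm hFi.integral_prod_left (fun a => by
      rw [hg]
      exact (norm_integral_le_of_norm_le_const (ae_of_all _ fun b => hF1 _)).trans (by simp))
  rw [MeasureTheory.integral_prod _ hFi]
  refine tendsto_nhds_unique ?_ hgen
  simp_rw [hg, ← net.integral_prod hF hF1]
  refine tendsto_integral_of_dominated_convergence (fun _ => 1) (fun n => ?_)
    (integrable_const 1) (fun n => ?_) ?_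
  · exact (Finset.measurable_prod _ fun i _ => hF.comp (hxm i)).aestronglyMeasurable
  · refine ae_of_all _ fun ω => ?_
    rw [norm_prod]
    exact Finset.prod_le_one (fun _ _ => norm_nonneg _) fun i _ => hF1 _
  · filter_upwards [net.ae_summable hf hfi] with ω hω
    simp only [F]
    simp_rw [← Complex.exp_sum, ← Finset.mul_sum, ← Complex.ofReal_sum]
    have hc : Continuous fun r : ℝ => Complex.exp (Complex.I * r) := by fun_prop
    exact (hc.tendsto _).comp hω.hasSum.tendsto_sum_nat

/-- A sum over the points of a marked sequence, as a function of positions and marks, written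
through positive and negative parts. -/
noncomputable def sumFunctional (f : Plane × M → ℝ) (q : (ℕ → Plane) × (ℕ → M)) : ℝ :=
  (∑' i, ENNReal.ofReal (f (q.1 i, q.2 i))).toReal -
    (∑' i, ENNReal.ofReal (-f (q.1 i, q.2 i))).toReal

/-- Sums in `ℝ≥0∞` are measurable without any convergence, so the two parts give an everywhere
measurable function of positions and marks. It agrees almost surely with the received signal and
transfers measurability and independence to it. -/
theorem measurable_sumFunctional {f : Plane × M → ℝ} (hf : Measurable f) :
    Measurable (sumFunctional f) := by
  have h : ∀ i, Measurable fun q : (ℕ → Plane) × (ℕ → M) => f (q.1 i, q.2 i) := fun i =>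
    hf.comp (((measurable_pi_apply i).comp measurable_fst).prodMk
      ((measurable_pi_apply i).comp measurable_snd))
  exact (Measurable.tsum fun i => (h i).ennreal_ofReal).ennreal_toReal.sub
    (Measurable.tsum fun i => (h i).neg.ennreal_ofReal).ennreal_toReal

theorem toReal_tsum_ofReal_sub {u : ℕ → ℝ} (hu : Summable u) :
    (∑' i, ENNReal.ofReal (u i)).toReal - (∑' i, ENNReal.ofReal (-u i)).toReal = ∑' i, u i := by
  have hp : ∀ {v : ℕ → ℝ}, Summable v → Summable fun i => max (v i) 0 := fun {v} hv =>
    hv.abs.of_nonneg_of_le (fun i => le_max_right _ _)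
      fun i => max_le (le_abs_self _) (abs_nonneg _)
  rw [ENNReal.tsum_toReal_eq fun i => ENNReal.ofReal_ne_top,
    ENNReal.tsum_toReal_eq fun i => ENNReal.ofReal_ne_top]
  simp_rw [ENNReal.toReal_ofReal']
  rw [← (hp hu).tsum_sub (hp hu.neg)]
  congr with i
  exact max_zero_sub_eq_self _

theorem IsMarkedPoissonNetwork.ae_eq_sumFunctional (net : IsMarkedPoissonNetwork x m lam P)
    {f : Plane × M → ℝ} (hf : Measurable f)
    (hfi : Integrable (fun p => min |f p| 1) ((intensity lam).prod (P.map (m 0)))) :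
    (fun ω => ∑' i, f (x i ω, m i ω)) =ᵐ[P]
      fun ω => sumFunctional f (fun i => x i ω, fun i => m i ω) := by
  filter_upwards [net.ae_summable hf hfi] with ω hω
  exact (toReal_tsum_ofReal_sub hω).symm

theorem IsMarkedPoissonNetwork.aemeasurable_tsum (net : IsMarkedPoissonNetwork x m lam P)
    {f : Plane × M → ℝ} (hf : Measurable f)
    (hfi : Integrable (fun p => min |f p| 1) ((intensity lam).prod (P.map (m 0)))) :
    AEMeasurable (fun ω => ∑' i, f (x i ω, m i ω)) P :=
  ⟨_, (measurable_sumFunctional hf).comp ((measurable_pi_lambda _ net.measurable_position).prodMk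
    (measurable_pi_lambda _ net.measurable_mark)), net.ae_eq_sumFunctional hf hfi⟩

end MarkedNetwork

end CoexistingWSN

namespace CoexistingWSN

open Filter Topology Set

/-! ### The oscillatory integral against `u ^ (-α - 1)`. -/

section FresnelIntegral

variable {α : ℝ}

/-- Convergence at 0 uses `α < 1`, convergence at infinity uses `0 < α`. This function dominates all
the integrands below, up to constants. -/
theorem integrableOn_min_mul_rpow (h0 : 0 < α) (h1 : α < 1) :
    IntegrableOn (fun u : ℝ => min u 1 * u ^ (-α - 1)) (Ioi 0) := by
  rw [← Ioc_union_Ioi_eq_Ioi zero_le_one]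
  refine IntegrableOn.union ?_ ?_
  · have h : IntegrableOn (fun u : ℝ => u ^ (-α)) (Ioc 0 1) := by
      rw [← intervalIntegrable_iff_integrableOn_Ioc_of_le zero_le_one]
      exact intervalIntegral.intervalIntegrable_rpow' (by linarith)
    refine h.congr_fun (fun u hu => ?_) measurableSet_Ioc
    have hu0 : (0 : ℝ) < u := hu.1
    simp only
    rw [min_eq_left hu.2, Real.rpow_sub_one hu0.ne']
    field_simp
  · have h : IntegrableOn (fun u : ℝ => u ^ (-α - 1)) (Ioi 1) :=
      integrableOn_Ioi_rpow_of_lt (by linarith) one_pos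
    refine h.congr_fun (fun u hu => ?_) measurableSet_Ioi
    simp only
    rw [min_eq_right (le_of_lt hu), one_mul]

theorem norm_exp_neg_mul_sub_one_le {z : ℂ} (hz : 0 ≤ z.re) {u : ℝ} (hu : 0 < u) :
    ‖Complex.exp (-z * u) - 1‖ ≤ 2 * max ‖z‖ 1 * min u 1 := by
  have hn : ‖-z * u‖ = ‖z‖ * u := by
    rw [norm_mul, norm_neg, Complex.norm_real, Real.norm_of_nonneg hu.le]
  have h2 : ‖Complex.exp (-z * u) - 1‖ ≤ 2 := by
    refine (norm_sub_le _ _).trans ?_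
    have : ‖Complex.exp (-z * u)‖ ≤ 1 := by
      rw [Complex.norm_exp, Real.exp_le_one_iff]
      simp only [neg_mul, Complex.neg_re, Complex.re_mul_ofReal]
      nlinarith
    rw [norm_one]
    linarith
  have h1 : ‖Complex.exp (-z * u) - 1‖ ≤ 2 * (‖z‖ * u) := by
    rcases le_total (‖z‖ * u) 1 with h | h
    · rw [← hn] at h ⊢
      exact Complex.norm_exp_sub_one_le h
    · linarith
  rcases min_choice u 1 with h | h <;> rw [h]
  · have := mul_le_mul_of_nonneg_right (le_max_left ‖z‖ 1) hu.le
    linarith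
  · linarith [le_max_right ‖z‖ 1]

/-- `∫ (exp (-z u) - 1) u ^ (-α - 1) du` over the positive half-line. -/
noncomputable def stableExponent (α : ℝ) (z : ℂ) : ℂ :=
  ∫ u in Ioi (0 : ℝ), (Complex.exp (-z * u) - 1) * (u ^ (-α - 1) : ℝ)

theorem aestronglyMeasurable_stableExponent (α : ℝ) (z : ℂ) :
    AEStronglyMeasurable (fun u : ℝ => (Complex.exp (-z * u) - 1) * (u ^ (-α - 1) : ℝ))
      (volume.restrict (Ioi 0)) :=
  Measurable.aestronglyMeasurable (by fun_prop)

theorem norm_stableExponent_integrand_le {z : ℂ} (hz : 0 ≤ z.re) {u : ℝ} (hu : u ∈ Ioi (0 : ℝ)) :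
    ‖(Complex.exp (-z * u) - 1) * (u ^ (-α - 1) : ℝ)‖ ≤
      2 * max ‖z‖ 1 * (min u 1 * u ^ (-α - 1)) := by
  have hu' : 0 < u := hu
  rw [norm_mul, Complex.norm_real, Real.norm_of_nonneg (by positivity), ← mul_assoc]
  exact mul_le_mul_of_nonneg_right (norm_exp_neg_mul_sub_one_le hz hu') (by positivity)

theorem integrableOn_stableExponent (h0 : 0 < α) (h1 : α < 1) {z : ℂ} (hz : 0 ≤ z.re) :
    IntegrableOn (fun u : ℝ => (Complex.exp (-z * u) - 1) * (u ^ (-α - 1) : ℝ)) (Ioi 0) := by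
  refine ((integrableOn_min_mul_rpow h0 h1).const_mul (2 * max ‖z‖ 1)).mono'
    (aestronglyMeasurable_stableExponent α z) ?_
  filter_upwards [ae_restrict_mem measurableSet_Ioi] with u hu
  exact norm_stableExponent_integrand_le hz hu

theorem integrableOn_rpow_mul_exp_neg {b s : ℝ} (hs : -1 < s) (hb : 0 < b) :
    IntegrableOn (fun u : ℝ => u ^ s * Real.exp (-b * u)) (Ioi 0) := by
  simpa using integrableOn_rpow_mul_exp_neg_mul_rpow (p := 1) hs one_pos hb

/-- Integration by parts on the positive real axis. -/
theorem stableExponent_ofReal (h0 : 0 < α) (h1 : α < 1) {r : ℝ} (hr : 0 < r) :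
    stableExponent α r = -(Real.Gamma (1 - α) / α : ℝ) * (r : ℂ) ^ (α : ℂ) := by
  have hd1 : ∀ u ∈ Ioi (0 : ℝ),
      HasDerivAt (fun u => Real.exp (-r * u) - 1) (-r * Real.exp (-r * u)) u := by
    intro u _
    have := (((hasDerivAt_id u).const_mul (-r)).exp).sub_const 1
    simpa [mul_comm] using this
  have hd2 : ∀ u ∈ Ioi (0 : ℝ), HasDerivAt (fun u => -α⁻¹ * u ^ (-α)) (u ^ (-α - 1)) u := by
    intro u hu
    have := (Real.hasDerivAt_rpow_const (p := -α) (Or.inl (ne_of_gt hu))).const_mul (-α⁻¹)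
    refine this.congr_deriv ?_
    field_simp
  have hre : (0 : ℝ) ≤ (r : ℂ).re := by simpa using hr.le
  have hcast : ∀ u : ℝ, (Complex.exp (-(r : ℂ) * u) - 1) * (u ^ (-α - 1) : ℝ) =
      (((Real.exp (-r * u) - 1) * u ^ (-α - 1) : ℝ) : ℂ) := fun u => by push_cast; rfl
  have hi1 : IntegrableOn (fun u => (Real.exp (-r * u) - 1) * u ^ (-α - 1)) (Ioi 0) := by
    have h := integrableOn_stableExponent h0 h1 hre
    simp_rw [hcast] at h
    exact h.re
  have hi2 := integrableOn_rpow_mul_exp_neg (s := -α) (by linarith) hr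
  -- One bound kills both boundary terms: it is of order `u ^ (1 - α)` at 0 and `u ^ (-α)` at
  -- infinity.
  have hbd : ∀ u ∈ Ioi (0 : ℝ), ‖(Real.exp (-r * u) - 1) * (-α⁻¹ * u ^ (-α))‖ ≤
      2 * max r 1 * α⁻¹ * (min u 1 * u ^ (-α)) := by
    intro u hu
    have hu' : 0 < u := hu
    have h := norm_exp_neg_mul_sub_one_le hre hu'
    have hc : Complex.exp (-(r : ℂ) * u) - 1 = ((Real.exp (-r * u) - 1 : ℝ) : ℂ) := by
      push_cast; rfl
    rw [hc, Complex.norm_real, Complex.norm_real, Real.norm_of_nonneg hr.le] at h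
    rw [norm_mul, norm_mul, norm_neg, Real.norm_of_nonneg (by positivity : 0 ≤ α⁻¹),
      Real.norm_of_nonneg (by positivity : 0 ≤ u ^ (-α))]
    have := mul_le_mul_of_nonneg_right h (by positivity : 0 ≤ α⁻¹ * u ^ (-α))
    linarith
  have hz : Tendsto ((fun u => Real.exp (-r * u) - 1) * fun u => -α⁻¹ * u ^ (-α))
      (𝓝[>] 0) (𝓝 0) := by
    refine squeeze_zero_norm' (a := fun u => 2 * max r 1 * α⁻¹ * u ^ (1 - α)) ?_ ?_
    · filter_upwards [self_mem_nhdsWithin] with u hu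
      have hu' : 0 < u := hu
      refine (hbd u hu).trans ?_
      rw [sub_eq_add_neg, Real.rpow_add hu', Real.rpow_one]
      gcongr
      exact min_le_left _ _
    · have : Tendsto (fun u : ℝ => u ^ (1 - α)) (𝓝 0) (𝓝 (0 ^ (1 - α))) :=
        (Real.continuousAt_rpow_const _ _ (Or.inr (by linarith))).tendsto
      rw [Real.zero_rpow (by linarith)] at this
      simpa using (this.mono_left nhdsWithin_le_nhds).const_mul (2 * max r 1 * α⁻¹)
  have hinf : Tendsto ((fun u => Real.exp (-r * u) - 1) * fun u => -α⁻¹ * u ^ (-α))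
      atTop (𝓝 0) := by
    refine squeeze_zero_norm' (a := fun u => 2 * max r 1 * α⁻¹ * u ^ (-α)) ?_ ?_
    · filter_upwards [eventually_gt_atTop 0] with u hu
      refine (hbd u hu).trans ?_
      have : min u 1 * u ^ (-α) ≤ 1 * u ^ (-α) := by
        gcongr
        exact min_le_right _ _
      rw [one_mul] at this
      gcongr
    · simpa using (tendsto_rpow_neg_atTop h0).const_mul (2 * max r 1 * α⁻¹)
  have hi3 : IntegrableOn ((fun u => -r * Real.exp (-r * u)) * fun u => -α⁻¹ * u ^ (-α))
      (Ioi 0) := by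
    refine (Integrable.const_mul hi2 (r * α⁻¹)).congr (ae_of_all _ fun u => ?_)
    simp only [Pi.mul_apply]
    ring
  have hparts := integral_Ioi_mul_deriv_eq_deriv_mul hd1 hd2 hi1 hi3 hz hinf
  have hgam := Real.integral_rpow_mul_exp_neg_mul_Ioi (a := 1 - α) (by linarith) hr
  have hval : ∫ u in Ioi (0 : ℝ), (Real.exp (-r * u) - 1) * u ^ (-α - 1) =
      -(Real.Gamma (1 - α) / α) * r ^ α := by
    rw [hparts]
    have : ∫ u in Ioi (0 : ℝ), -r * Real.exp (-r * u) * (-α⁻¹ * u ^ (-α)) =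
        ∫ u in Ioi (0 : ℝ), (r * α⁻¹) * (u ^ (1 - α - 1) * Real.exp (-(r * u))) := by
      congr with u
      rw [show 1 - α - 1 = -α by ring, neg_mul r u]
      ring
    rw [this, integral_const_mul, hgam, one_div, Real.inv_rpow hr.le, ← Real.rpow_neg hr.le,
      neg_sub, Real.rpow_sub_one hr.ne']
    field_simp
    ring
  rw [stableExponent]
  simp_rw [hcast]
  rw [integral_complex_ofReal, hval]
  push_cast
  rw [Complex.ofReal_cpow hr.le]

/-- Differentiation under the integral sign. On the ball of radius `z.re / 2` real parts stay above
`z.re / 2`, which gives an integrable exponential bound for the derivative. -/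
theorem differentiableOn_stableExponent (h0 : 0 < α) (h1 : α < 1) :
    DifferentiableOn ℂ (stableExponent α) {z | 0 < z.re} := by
  intro z hz
  have hz' : 0 < z.re := hz
  refine DifferentiableAt.differentiableWithinAt (HasDerivAt.differentiableAt
    (f' := ∫ u in Ioi (0 : ℝ), (-u * Complex.exp (-z * u)) * (u ^ (-α - 1) : ℝ)) ?_)
  have hball : ∀ w ∈ Metric.ball z (z.re / 2), z.re / 2 ≤ w.re := by
    intro w hw
    rw [mem_ball_iff_norm] at hw
    have := (abs_le.1 ((Complex.abs_re_le_norm (w - z)).trans hw.le)).1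
    simp only [Complex.sub_re] at this
    linarith
  refine (hasDerivAt_integral_of_dominated_loc_of_deriv_le
    (F := fun (w : ℂ) (u : ℝ) => (Complex.exp (-w * u) - 1) * (u ^ (-α - 1) : ℝ))
    (F' := fun (w : ℂ) (u : ℝ) => (-u * Complex.exp (-w * u)) * (u ^ (-α - 1) : ℝ))
    (bound := fun u => u ^ (-α) * Real.exp (-(z.re / 2) * u))
    (s := Metric.ball z (z.re / 2)) (Metric.ball_mem_nhds z (by linarith))
    (Eventually.of_forall fun w => aestronglyMeasurable_stableExponent α w)
    (integrableOn_stableExponent h0 h1 hz'.le)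
    (Measurable.aestronglyMeasurable (by fun_prop)) ?_
    (integrableOn_rpow_mul_exp_neg (by linarith) (by linarith)) ?_).2
  · filter_upwards [ae_restrict_mem measurableSet_Ioi] with u hu w hw
    have hu' : 0 < u := hu
    rw [norm_mul, norm_mul, norm_neg, Complex.norm_real, Complex.norm_real,
      Real.norm_of_nonneg hu'.le, Real.norm_of_nonneg (by positivity), Complex.norm_exp,
      Real.rpow_sub_one hu'.ne']
    have : Real.exp (-w * u : ℂ).re ≤ Real.exp (-(z.re / 2) * u) := by
      rw [Real.exp_le_exp]
      simp only [neg_mul, Complex.neg_re, Complex.re_mul_ofReal]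
      nlinarith [hball w hw]
    calc u * Real.exp (-w * u : ℂ).re * (u ^ (-α) / u)
        = u ^ (-α) * Real.exp (-w * u : ℂ).re := by field_simp
      _ ≤ _ := by gcongr
  · refine ae_of_all _ fun u w _ => ?_
    have := ((((hasDerivAt_id w).neg.mul_const (u : ℂ)).cexp).sub_const 1).mul_const
      ((u ^ (-α - 1) : ℝ) : ℂ)
    refine this.congr_deriv ?_
    simp only [id, Pi.neg_apply]
    ring

/-- Identity theorem: both sides are analytic on the half-plane and agree on the positive axis, in
particular along `1 + 1/(n+1)`, which accumulates at 1. -/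
theorem stableExponent_of_re_pos (h0 : 0 < α) (h1 : α < 1) {z : ℂ} (hz : 0 < z.re) :
    stableExponent α z = -(Real.Gamma (1 - α) / α : ℝ) * z ^ (α : ℂ) := by
  have hopen : IsOpen {z : ℂ | 0 < z.re} := isOpen_lt continuous_const Complex.continuous_re
  have hf := (differentiableOn_stableExponent h0 h1).analyticOnNhd hopen
  have hg : AnalyticOnNhd ℂ (fun z : ℂ => -(Real.Gamma (1 - α) / α : ℝ) * z ^ (α : ℂ))
      {z | 0 < z.re} := by
    refine DifferentiableOn.analyticOnNhd (fun w hw => ?_) hopen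
    refine DifferentiableAt.differentiableWithinAt ?_
    exact ((differentiableAt_id).cpow_const (Or.inl hw)).const_mul _
  refine hf.eqOn_of_preconnected_of_frequently_eq hg
    (convex_halfSpace_re_gt 0).isPreconnected (z₀ := 1) (by simp) ?_ hz
  have ht : Tendsto (fun n : ℕ => ((1 + 1 / ((n : ℝ) + 1) : ℝ) : ℂ)) atTop (𝓝[≠] 1) := by
    refine tendsto_nhdsWithin_iff.2 ⟨?_, Eventually.of_forall fun n => ?_⟩
    · have := (tendsto_one_div_add_atTop_nhds_zero_nat (𝕜 := ℝ)).const_add 1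
      rw [add_zero] at this
      exact_mod_cast (Complex.continuous_ofReal.tendsto _).comp this
    · have : (0 : ℝ) < 1 / ((n : ℝ) + 1) := by positivity
      rw [mem_compl_singleton_iff, Ne, Complex.ofReal_eq_one]
      linarith
  refine ht.frequently (Frequently.of_forall fun n => ?_)
  exact stableExponent_ofReal h0 h1 (by positivity)

/-- The integral of `(1 - exp (i s u)) u ^ (-α - 1)` over the positive half-line. -/
theorem integral_one_sub_exp_I_mul_rpow (h0 : 0 < α) (h1 : α < 1) (s : ℝ) :
    ∫ u in Ioi (0 : ℝ), (u ^ (-α - 1)) • (1 - Complex.exp (Complex.I * (s * u : ℝ))) =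
      (Real.Gamma (1 - α) / α * |s| ^ α : ℝ) *
        (Real.cos (Real.pi * α / 2) - Complex.I * Real.sign s * Real.sin (Real.pi * α / 2)) := by
  rcases eq_or_ne s 0 with rfl | hs
  · simp [Real.zero_rpow h0.ne']
  -- The point `-is` lies on the boundary of the half-plane and is approached from inside: the
  -- integral converges by domination, and the closed form by continuity of the principal power off
  -- the slit.
  have hlim1 : Tendsto (fun n : ℕ => stableExponent α ((1 / ((n : ℝ) + 1) : ℝ) - Complex.I * s))
      atTop (𝓝 (stableExponent α (-(Complex.I * s)))) := by
    have hre : ∀ n : ℕ, 0 ≤ (((1 / ((n : ℝ) + 1) : ℝ) : ℂ) - Complex.I * s).re := by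
      intro n
      simp only [Complex.sub_re, Complex.ofReal_re, Complex.mul_re, Complex.I_re, Complex.I_im,
        Complex.ofReal_im]
      have : (0 : ℝ) < 1 / ((n : ℝ) + 1) := by positivity
      linarith
    refine tendsto_integral_of_dominated_convergence
      (fun u => 2 * max (1 + |s|) 1 * (min u 1 * u ^ (-α - 1)))
      (fun n => aestronglyMeasurable_stableExponent α _)
      ((integrableOn_min_mul_rpow h0 h1).const_mul _) (fun n => ?_) (ae_of_all _ fun u => ?_)
    · filter_upwards [ae_restrict_mem measurableSet_Ioi] with u hu
      have hu' : 0 < u := hu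
      refine (norm_stableExponent_integrand_le (hre n) hu).trans ?_
      have : ‖((1 / ((n : ℝ) + 1) : ℝ) : ℂ) - Complex.I * s‖ ≤ 1 + |s| := by
        refine (norm_sub_le _ _).trans ?_
        rw [norm_mul, Complex.norm_I, one_mul, Complex.norm_real, Complex.norm_real,
          Real.norm_of_nonneg (by positivity), Real.norm_eq_abs]
        gcongr
        rw [div_le_one (by positivity)]
        linarith [(Nat.cast_nonneg n : (0 : ℝ) ≤ n)]
      have h3 : 0 ≤ min u 1 := le_min hu'.le zero_le_one
      gcongr
    · have hc : Continuous fun e : ℝ =>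
          (Complex.exp (-((e : ℂ) - Complex.I * s) * u) - 1) * (u ^ (-α - 1) : ℝ) := by
        fun_prop
      have := (hc.tendsto 0).comp (tendsto_one_div_add_atTop_nhds_zero_nat (𝕜 := ℝ))
      simpa [Function.comp_def] using this
  have hslit : -(Complex.I * s) ∈ Complex.slitPlane := by
    right
    simpa using hs
  have hlim2 : Tendsto (fun n : ℕ => stableExponent α ((1 / ((n : ℝ) + 1) : ℝ) - Complex.I * s))
      atTop (𝓝 (-(Real.Gamma (1 - α) / α : ℝ) * (-(Complex.I * s)) ^ (α : ℂ))) := by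
    have h : ∀ n : ℕ, stableExponent α ((1 / ((n : ℝ) + 1) : ℝ) - Complex.I * s) =
        -(Real.Gamma (1 - α) / α : ℝ) *
          (((1 / ((n : ℝ) + 1) : ℝ) : ℂ) - Complex.I * s) ^ (α : ℂ) := by
      intro n
      refine stableExponent_of_re_pos h0 h1 ?_
      simp only [Complex.sub_re, Complex.ofReal_re, Complex.mul_re, Complex.I_re, Complex.I_im,
        Complex.ofReal_im]
      have : (0 : ℝ) < 1 / ((n : ℝ) + 1) := by positivity
      linarith
    simp_rw [h]
    refine Tendsto.const_mul _ ?_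
    have h2 : Tendsto (fun n : ℕ => ((1 / ((n : ℝ) + 1) : ℝ) : ℂ) - Complex.I * s) atTop
        (𝓝 (-(Complex.I * s))) := by
      have := ((Complex.continuous_ofReal.tendsto _).comp
        (tendsto_one_div_add_atTop_nhds_zero_nat (𝕜 := ℝ))).sub_const (Complex.I * s)
      simpa [Function.comp_def] using this
    exact (continuousAt_cpow_const hslit).tendsto.comp h2
  have hkey := tendsto_nhds_unique hlim1 hlim2
  have hleft : ∫ u in Ioi (0 : ℝ), (u ^ (-α - 1)) • (1 - Complex.exp (Complex.I * (s * u : ℝ))) =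
      -stableExponent α (-(Complex.I * s)) := by
    rw [stableExponent, ← integral_neg]
    congr with u
    rw [Complex.real_smul, neg_neg]
    push_cast
    rw [mul_assoc Complex.I]
    ring
  rw [hleft, hkey]
  -- The argument of `-is` is `-π/2` times the sign of `s`.
  have hpow : (-(Complex.I * s)) ^ (α : ℂ) = (|s| ^ α : ℝ) *
      (Real.cos (Real.pi * α / 2) - Complex.I * Real.sign s * Real.sin (Real.pi * α / 2)) := by
    have hlog : ∀ {r e : ℝ}, 0 < r → (e = 1 ∨ e = -1) →
        Complex.log (-(Complex.I * (e * r))) = Real.log r - (Real.pi / 2) * e * Complex.I := by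
      rintro r e hr (rfl | rfl)
      · rw [show -(Complex.I * ((1 : ℝ) * r)) = r * (-Complex.I) by push_cast; ring,
          Complex.log_ofReal_mul hr (neg_ne_zero.2 Complex.I_ne_zero), Complex.log_neg_I]
        push_cast
        ring
      · rw [show -(Complex.I * ((-1 : ℝ) * r)) = r * Complex.I by push_cast; ring,
          Complex.log_ofReal_mul hr Complex.I_ne_zero, Complex.log_I]
        push_cast
        ring
    have hpol : ∀ {r e : ℝ}, 0 < r → (e = 1 ∨ e = -1) →
        (-(Complex.I * (e * r))) ^ (α : ℂ) = (r ^ α : ℝ) *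
          (Real.cos (Real.pi * α / 2) - Complex.I * e * Real.sin (Real.pi * α / 2)) := by
      intro r e hr he
      have he0 : (e : ℂ) ≠ 0 := by rcases he with rfl | rfl <;> simp
      have hr0 : (r : ℂ) ≠ 0 := Complex.ofReal_ne_zero.2 hr.ne'
      rw [Complex.cpow_def_of_ne_zero
        (neg_ne_zero.2 (mul_ne_zero Complex.I_ne_zero (mul_ne_zero he0 hr0))), hlog hr he,
        Real.rpow_def_of_pos hr, sub_mul, sub_eq_add_neg, Complex.exp_add]
      push_cast
      congr 1
      rcases he with rfl | rfl
      · rw [show -(Real.pi / 2 * ((1 : ℝ) : ℂ) * Complex.I * α) =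
          (-(Real.pi * α / 2)) * Complex.I by push_cast; ring, Complex.exp_mul_I,
          Complex.cos_neg, Complex.sin_neg]
        push_cast
        ring
      · rw [show -(Real.pi / 2 * ((-1 : ℝ) : ℂ) * Complex.I * α) =
          (Real.pi * α / 2) * Complex.I by push_cast; ring, Complex.exp_mul_I]
        push_cast
        ring
    have hsign : Real.sign s = 1 ∨ Real.sign s = -1 := by
      rcases lt_or_gt_of_ne hs with h | h
      · exact Or.inr (Real.sign_of_neg h)
      · exact Or.inl (Real.sign_of_pos h)
    have hs2 : (s : ℂ) = (Real.sign s : ℂ) * (|s| : ℝ) := by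
      rw [← Complex.ofReal_mul]
      congr 1
      rcases lt_or_gt_of_ne hs with h | h
      · rw [Real.sign_of_neg h, abs_of_neg h]
        ring
      · rw [Real.sign_of_pos h, abs_of_pos h, one_mul]
    rw [← hpol (abs_pos.2 hs) hsign, ← hs2]
  rw [hpow]
  push_cast
  ring

end FresnelIntegral

end CoexistingWSN

namespace CoexistingWSN

open Filter Topology Set

/-! ### From the plane to the half-line of path gains. -/

section PlaneIntegral

variable {F : Type*} [NormedAddCommGroup F] [NormedSpace ℝ F] {δ α : ℝ}

/-- Jacobian of `u = r ^ (-δ)`: the polar density `r dr` becomes `δ⁻¹ u ^ (-2/δ - 1) du`. The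
exponent `2 - 1` is the dimension minus one. -/
theorem pow_one_smul_eq_rpow_smul (hδ : 0 < δ) (g : ℝ → F) {r : ℝ} (hr : r ∈ Ioi (0 : ℝ)) :
    r ^ (2 - 1) • g (r ^ (-δ)) =
      (|-δ| * r ^ (-δ - 1)) • (δ⁻¹ • ((r ^ (-δ)) ^ (-(2 / δ) - 1) • g (r ^ (-δ)))) := by
  have hr' : 0 < r := hr
  rw [smul_smul, smul_smul, abs_neg, abs_of_pos hδ, ← Real.rpow_mul hr'.le]
  congr 1
  rw [show -δ * (-(2 / δ) - 1) = 2 + δ by field_simp; ring]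
  have : r ^ (-δ - 1) * r ^ (2 + δ) = r := by
    rw [← Real.rpow_add hr', show -δ - 1 + (2 + δ) = 1 by ring, Real.rpow_one]
  calc r ^ (2 - 1) = r ^ (-δ - 1) * r ^ (2 + δ) := by rw [this]; simp
    _ = δ * r ^ (-δ - 1) * δ⁻¹ * r ^ (2 + δ) := by field_simp

/-- Integration over the plane of a function of the path gain `‖x‖ ^ (-δ)`. -/
theorem integral_plane_comp_norm_rpow (hδ : 0 < δ) (g : ℝ → F) :
    ∫ x : Plane, g (‖x‖ ^ (-δ)) =
      (Real.pi * (2 / δ)) • ∫ u in Ioi (0 : ℝ), u ^ (-(2 / δ) - 1) • g u := by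
  have h := integral_fun_norm_addHaar (volume : Measure Plane) (fun r : ℝ => g (r ^ (-δ)))
  have hvol : (volume : Measure Plane).real (Metric.ball 0 1) = Real.pi := by
    rw [measureReal_def, EuclideanSpace.volume_ball_fin_two]
    simp [Real.pi_pos.le]
  rw [h, hvol, finrank_euclideanSpace_fin,
    setIntegral_congr_fun measurableSet_Ioi fun r hr => pow_one_smul_eq_rpow_smul hδ g hr,
    integral_comp_rpow_Ioi (fun u => δ⁻¹ • (u ^ (-(2 / δ) - 1) • g u)) (neg_ne_zero.2 hδ.ne'),
    integral_smul, smul_smul, ← Nat.cast_smul_eq_nsmul ℝ, smul_smul]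
  congr 1
  push_cast
  ring

theorem integrable_plane_comp_norm_rpow (hδ : 0 < δ) {g : ℝ → F}
    (hg : IntegrableOn (fun u : ℝ => u ^ (-(2 / δ) - 1) • g u) (Ioi 0)) :
    Integrable fun x : Plane => g (‖x‖ ^ (-δ)) := by
  refine (integrable_fun_norm_addHaar (volume : Measure Plane)
    (f := fun r : ℝ => g (r ^ (-δ)))).2 ?_
  rw [finrank_euclideanSpace_fin]
  refine IntegrableOn.congr_fun ?_ (fun r hr => (pow_one_smul_eq_rpow_smul hδ g hr).symm)
    measurableSet_Ioi
  exact (integrableOn_Ioi_comp_rpow_iff (fun u => δ⁻¹ • (u ^ (-(2 / δ) - 1) • g u))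
    (neg_ne_zero.2 hδ.ne')).2 (Integrable.smul δ⁻¹ hg)

theorem div_norm_rpow_eq (s δ : ℝ) (x : Plane) : s / ‖x‖ ^ δ = s * ‖x‖ ^ (-δ) := by
  rw [Real.rpow_neg (norm_nonneg _), div_eq_mul_inv]

theorem rpow_smul_min_abs_mul {s : ℝ} (hs : s ≠ 0) {u : ℝ} (hu : u ∈ Ioi (0 : ℝ)) :
    u ^ (-α - 1) • min |s * u| 1 =
      |s| ^ α * (|s| * (min (|s| * u) 1 * (|s| * u) ^ (-α - 1))) := by
  have hu' : 0 < u := hu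
  have hs' := abs_pos.2 hs
  rw [abs_mul, abs_of_pos hu', Real.mul_rpow hs'.le hu'.le, smul_eq_mul]
  have : |s| ^ α * |s| * |s| ^ (-α - 1) = 1 := by
    rw [Real.rpow_sub_one hs'.ne', Real.rpow_neg hs'.le]
    have := (Real.rpow_pos_of_pos hs' α).ne'
    field_simp
  calc u ^ (-α - 1) * min (|s| * u) 1
      = (|s| ^ α * |s| * |s| ^ (-α - 1)) * (u ^ (-α - 1) * min (|s| * u) 1) := by
        rw [this, one_mul]
    _ = _ := by ring

theorem integrableOn_rpow_smul_min (h0 : 0 < α) (h1 : α < 1) (s : ℝ) :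
    IntegrableOn (fun u : ℝ => u ^ (-α - 1) • min |s * u| 1) (Ioi 0) := by
  rcases eq_or_ne s 0 with rfl | hs
  · simp
  · refine IntegrableOn.congr_fun (Integrable.const_mul (Integrable.const_mul ?_ |s|) (|s| ^ α))
      (fun u hu => (rpow_smul_min_abs_mul hs hu).symm) measurableSet_Ioi
    refine (integrableOn_Ioi_comp_mul_left_iff (fun v => min v 1 * v ^ (-α - 1)) 0
      (abs_pos.2 hs)).2 ?_
    rw [mul_zero]
    exact integrableOn_min_mul_rpow h0 h1

/-- Substitute `v = |s| u`. The value of the remaining integral is immaterial; the factor `|s| ^ α`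
makes a moment of order `α` sufficient for summability. -/
theorem integral_rpow_smul_min (h0 : 0 < α) (s : ℝ) :
    ∫ u in Ioi (0 : ℝ), u ^ (-α - 1) • min |s * u| 1 =
      |s| ^ α * ∫ v in Ioi (0 : ℝ), min v 1 * v ^ (-α - 1) := by
  rcases eq_or_ne s 0 with rfl | hs
  · simp [Real.zero_rpow h0.ne']
  · have hs' := abs_pos.2 hs
    rw [setIntegral_congr_fun measurableSet_Ioi fun u hu => rpow_smul_min_abs_mul hs hu,
      integral_const_mul, integral_const_mul,
      integral_comp_mul_left_Ioi (fun v => min v 1 * v ^ (-α - 1)) 0 hs', mul_zero, smul_eq_mul,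
      mul_inv_cancel_left₀ hs'.ne']

theorem two_div_pos (hδ : 2 < δ) : 0 < 2 / δ := div_pos two_pos (by linarith)

theorem two_div_lt_one (hδ : 2 < δ) : 2 / δ < 1 := (div_lt_one (by linarith)).2 hδ

theorem integrable_plane_min (hδ : 2 < δ) (s : ℝ) :
    Integrable fun x : Plane => min |s / ‖x‖ ^ δ| 1 := by
  simp_rw [div_norm_rpow_eq]
  exact integrable_plane_comp_norm_rpow (g := fun u => min |s * u| 1) (by linarith)
    (integrableOn_rpow_smul_min (two_div_pos hδ) (two_div_lt_one hδ) s)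

theorem integral_plane_min (hδ : 2 < δ) (s : ℝ) :
    ∫ x : Plane, min |s / ‖x‖ ^ δ| 1 =
      Real.pi * (2 / δ) * (∫ v in Ioi (0 : ℝ), min v 1 * v ^ (-(2 / δ) - 1)) * |s| ^ (2 / δ) := by
  simp_rw [div_norm_rpow_eq]
  rw [integral_plane_comp_norm_rpow (g := fun u => min |s * u| 1) (by linarith),
    integral_rpow_smul_min (two_div_pos hδ), smul_eq_mul]
  ring

theorem integral_plane_one_sub_exp (hδ : 2 < δ) (s : ℝ) :
    ∫ x : Plane, (1 - Complex.exp (Complex.I * (s / ‖x‖ ^ δ : ℝ))) =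
      (Real.pi * Real.Gamma (1 - 2 / δ) * |s| ^ (2 / δ) : ℝ) *
        (Real.cos (Real.pi * (2 / δ) / 2) -
          Complex.I * Real.sign s * Real.sin (Real.pi * (2 / δ) / 2)) := by
  simp_rw [div_norm_rpow_eq]
  rw [integral_plane_comp_norm_rpow (g := fun u => 1 - Complex.exp (Complex.I * (s * u : ℝ)))
    (by linarith), integral_one_sub_exp_I_mul_rpow (two_div_pos hδ) (two_div_lt_one hδ),
    Complex.real_smul, ← mul_assoc, ← Complex.ofReal_mul]
  congr 2
  have : δ ≠ 0 := by linarith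
  field_simp

end PlaneIntegral

/-! ### Stable laws of aggregates and of independent sums. -/

section StableLaw

theorem sign_mul (a b : ℝ) : Real.sign (a * b) = Real.sign a * Real.sign b := by
  rcases lt_trichotomy a 0 with ha | rfl | ha <;> rcases lt_trichotomy b 0 with hb | rfl | hb <;>
    simp [Real.sign_of_neg, Real.sign_of_pos, mul_pos_of_neg_of_neg, mul_neg_of_neg_of_pos,
      mul_neg_of_pos_of_neg, *]

theorem abs_sign_le_one (a : ℝ) : |Real.sign a| ≤ 1 := by
  rcases Real.sign_apply_eq a with h | h | h <;> simp [h]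

theorem measurable_sign : Measurable Real.sign :=
  Measurable.ite measurableSet_Iio measurable_const
    (Measurable.ite measurableSet_Ioi measurable_const measurable_const)

variable {Ω M : Type*} [MeasurableSpace Ω] [MeasurableSpace M] {P : Measure Ω}
  {x : ℕ → Ω → Plane} {m : ℕ → Ω → M} {lam δ : ℝ}

theorem integral_intensity {F : Type*} [NormedAddCommGroup F] [NormedSpace ℝ F] (hlam : 0 ≤ lam)
    (f : Plane → F) : ∫ y, f y ∂(intensity lam) = lam • ∫ y, f y := by
  rw [intensity, integral_smul_measure, ENNReal.toReal_ofReal hlam]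

theorem measurable_gain {a : M → ℝ} (ha : Measurable a) (δ : ℝ) :
    Measurable fun p : Plane × M => a p.2 / ‖p.1‖ ^ δ := by fun_prop

variable {ν : Measure M} [IsProbabilityMeasure ν]

/-- Integrating over the plane first leaves a constant times `|a b| ^ (2 / δ)`. -/
theorem integrable_min_gain (hδ : 2 < δ) (hlam : 0 ≤ lam) {a : M → ℝ} (ha : Measurable a)
    (hi : Integrable (fun b => |a b| ^ (2 / δ)) ν) :
    Integrable (fun p : Plane × M => min |a p.2 / ‖p.1‖ ^ δ| 1) ((intensity lam).prod ν) := by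
  have hm : Measurable fun p : Plane × M => min |a p.2 / ‖p.1‖ ^ δ| 1 :=
    (measurable_abs.comp (measurable_gain ha δ)).min measurable_const
  refine (integrable_prod_iff' hm.aestronglyMeasurable).2 ⟨ae_of_all _ fun b =>
    (integrable_plane_min hδ (a b)).smul_measure ENNReal.ofReal_ne_top, ?_⟩
  have h : ∀ b, ∫ y, ‖min |a b / ‖y‖ ^ δ| 1‖ ∂(intensity lam) =
      lam * (Real.pi * (2 / δ) * (∫ v in Ioi (0 : ℝ), min v 1 * v ^ (-(2 / δ) - 1))) *
        |a b| ^ (2 / δ) := by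
    intro b
    simp_rw [fun y : Plane => Real.norm_of_nonneg
      (le_min (abs_nonneg (a b / ‖y‖ ^ δ)) (zero_le_one' ℝ))]
    rw [integral_intensity hlam, integral_plane_min hδ, smul_eq_mul]
    ring
  simp_rw [h]
  exact hi.const_mul _

/-- The plane integral at a fixed mark has the cosine with `|a|^α` and the sine with `sign(a)|a|^α`;
averaging over marks produces the absolute and the signed moment, hence scale and skew. -/
theorem integral_one_sub_exp_gain (hδ : 2 < δ) (hlam : 0 ≤ lam) {a : M → ℝ} (ha : Measurable a)
    (hi : Integrable (fun b => |a b| ^ (2 / δ)) ν) :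
    ∫ p : Plane × M, (1 - Complex.exp (Complex.I * (a p.2 / ‖p.1‖ ^ δ : ℝ)))
        ∂((intensity lam).prod ν) =
      (lam * (Real.pi * Real.Gamma (1 - 2 / δ)) : ℝ) *
        ((Real.cos (Real.pi * (2 / δ) / 2) * ∫ b, |a b| ^ (2 / δ) ∂ν : ℝ) -
          Complex.I * (Real.sin (Real.pi * (2 / δ) / 2) *
            ∫ b, Real.sign (a b) * |a b| ^ (2 / δ) ∂ν : ℝ)) := by
  have hprod := integrable_one_sub_exp (measurable_gain ha δ) (integrable_min_gain hδ hlam ha hi)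
  have hi2 : Integrable (fun b => Real.sign (a b) * |a b| ^ (2 / δ)) ν := by
    refine hi.mono' ((measurable_sign.comp ha).mul
      (by fun_prop : Measurable fun b => |a b| ^ (2 / δ))).aestronglyMeasurable
      (ae_of_all _ fun b => ?_)
    have h0 : 0 ≤ |a b| ^ (2 / δ) := by positivity
    rw [norm_mul, Real.norm_of_nonneg h0, Real.norm_eq_abs]
    exact mul_le_of_le_one_left h0 (abs_sign_le_one _)
  rw [integral_prod_symm _ hprod]
  simp_rw [integral_intensity hlam, integral_plane_one_sub_exp hδ]
  have h : ∀ b, lam • (((Real.pi * Real.Gamma (1 - 2 / δ) * |a b| ^ (2 / δ) : ℝ) : ℂ) *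
      (Real.cos (Real.pi * (2 / δ) / 2) -
        Complex.I * Real.sign (a b) * Real.sin (Real.pi * (2 / δ) / 2))) =
      (lam * (Real.pi * Real.Gamma (1 - 2 / δ)) : ℝ) *
        ((Real.cos (Real.pi * (2 / δ) / 2) * |a b| ^ (2 / δ) : ℝ) -
          Complex.I * (Real.sin (Real.pi * (2 / δ) / 2) *
            (Real.sign (a b) * |a b| ^ (2 / δ)) : ℝ)) := by
    intro b
    rw [Complex.real_smul]
    push_cast
    ring
  simp_rw [h]
  rw [integral_const_mul, integral_sub, integral_const_mul, integral_complex_ofReal,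
    integral_complex_ofReal, integral_const_mul, integral_const_mul]
  · exact (hi.const_mul _).ofReal
  · exact (hi2.const_mul _).ofReal.const_mul _

/-- `Γ(2 - α) = (1 - α) Γ(1 - α)` cancels the numerator of the constant. The cosine that stays in
the scale turns the sine of the exponent into the tangent of `stableOmega`. -/
theorem inv_stableConst {α : ℝ} (h1 : α < 1) :
    Real.pi / 2 * (stableConst α)⁻¹ =
      Real.pi * Real.Gamma (1 - α) * Real.cos (Real.pi * α / 2) := by
  have h : 1 - α ≠ 0 := by linarith
  rw [stableConst, inv_div, show 2 - α = 1 - α + 1 by ring, Real.Gamma_add_one h]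
  field_simp

theorem cos_pi_mul_div_two_pos {α : ℝ} (h0 : 0 < α) (h1 : α < 1) :
    0 < Real.cos (Real.pi * α / 2) := by
  refine Real.cos_pos_of_mem_Ioo ⟨?_, ?_⟩ <;> nlinarith [Real.pi_pos]

theorem pi_div_two_mul_inv_stableConst_pos {α : ℝ} (h0 : 0 < α) (h1 : α < 1) :
    0 < Real.pi / 2 * (stableConst α)⁻¹ := by
  rw [inv_stableConst h1]
  have := cos_pi_mul_div_two_pos h0 h1
  have := Real.Gamma_pos_of_pos (by linarith : 0 < 1 - α)
  have := Real.pi_pos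
  positivity

variable [IsProbabilityMeasure P]

/-- The aggregate of the emissions of a marked Poisson network follows a stable law, whose skew
compares the signed and the absolute moments of the emissions. -/
theorem IsMarkedPoissonNetwork.isStableLaw_aggregate (net : IsMarkedPoissonNetwork x m lam P)
    (hδ : 2 < δ) (hlam : 0 ≤ lam) {a : M → ℝ} (ha : Measurable a)
    (hi : Integrable (fun b => |a b| ^ (2 / δ)) (P.map (m 0))) {β σ : ℝ} (hβ : β ∈ Icc (-1) 1)
    (hβ' : ∫ b, Real.sign (a b) * |a b| ^ (2 / δ) ∂(P.map (m 0)) =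
      β * ∫ b, |a b| ^ (2 / δ) ∂(P.map (m 0))) (hσ : 0 < σ)
    (hσ' : σ ^ (2 / δ) = lam * (Real.pi / 2) * (stableConst (2 / δ))⁻¹ *
      ∫ b, |a b| ^ (2 / δ) ∂(P.map (m 0))) :
    IsStableLaw (P.map (aggregate δ x fun i ω => a (m i ω))) (2 / δ) σ β 0 := by
  have := net.isProbabilityMeasure_map_mark
  have h0 := two_div_pos hδ
  have h1 := two_div_lt_one hδ
  have hagg : aggregate δ x (fun i ω => a (m i ω)) =
      fun ω => ∑' i, (fun p : Plane × M => a p.2 / ‖p.1‖ ^ δ) (x i ω, m i ω) := rfl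
  have hmeas : AEMeasurable (aggregate δ x fun i ω => a (m i ω)) P :=
    net.aemeasurable_tsum (measurable_gain ha δ) (integrable_min_gain hδ hlam ha hi)
  refine ⟨h0, by linarith, hσ, hβ.1, hβ.2, Measure.isProbabilityMeasure_map hmeas, fun t => ?_⟩
  have habs : ∀ b, |t * a b| ^ (2 / δ) = |t| ^ (2 / δ) * |a b| ^ (2 / δ) := fun b => by
    rw [abs_mul, Real.mul_rpow (abs_nonneg _) (abs_nonneg _)]
  have hti : Integrable (fun b => |t * a b| ^ (2 / δ)) (P.map (m 0)) := by
    simp_rw [habs]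
    exact hi.const_mul _
  have hta : Measurable fun b => t * a b := ha.const_mul t
  -- The frequency is absorbed into the emission, so the exponential formula is used for `t * a`.
  have hsum : ∀ ω, (t * aggregate δ x (fun i ω => a (m i ω)) ω) =
      ∑' i, (fun p : Plane × M => t * a p.2 / ‖p.1‖ ^ δ) (x i ω, m i ω) := by
    intro ω
    rw [hagg, ← tsum_mul_left]
    simp only [mul_div_assoc]
  have hcf := net.integral_exp_tsum (measurable_gain hta δ) (integrable_min_gain hδ hlam hta hti)
  simp_rw [← hsum] at hcf
  rw [charFun_apply_real, integral_map hmeas (Measurable.aestronglyMeasurable (by fun_prop))]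
  have hcomm : ∀ ω, (t : ℂ) * (aggregate δ x (fun i ω => a (m i ω)) ω : ℂ) * Complex.I =
      Complex.I * ((t * aggregate δ x (fun i ω => a (m i ω)) ω : ℝ) : ℂ) := fun ω => by
    push_cast
    ring
  simp_rw [hcomm]
  rw [hcf, integral_one_sub_exp_gain hδ hlam hta hti, stableCharFun]
  congr 1
  have hsgn : ∀ b, Real.sign (t * a b) * |t * a b| ^ (2 / δ) =
      Real.sign t * |t| ^ (2 / δ) * (Real.sign (a b) * |a b| ^ (2 / δ)) := fun b => by
    rw [habs, sign_mul]
    ring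
  simp_rw [hsgn, habs]
  have hcos := (cos_pi_mul_div_two_pos h0 h1).ne'
  rw [integral_const_mul, integral_const_mul, hβ', abs_mul, abs_of_pos hσ,
    Real.mul_rpow hσ.le (abs_nonneg _), hσ', stableOmega, if_neg h1.ne, Real.tan_eq_sin_div_cos,
    mul_assoc lam, inv_stableConst h1]
  have hcos' : (Real.cos (Real.pi * (2 / δ) / 2) : ℂ) ≠ 0 := Complex.ofReal_ne_zero.2 hcos
  rw [Complex.ofReal_div]
  simp only [Complex.ofReal_mul, Complex.ofReal_zero]
  generalize (Real.cos (Real.pi * (2 / δ) / 2) : ℂ) = c at hcos' ⊢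
  generalize (Real.sin (Real.pi * (2 / δ) / 2) : ℂ) = s
  field_simp
  ring

/-- The sum of independent stable variables with the same exponent. -/
theorem IsStableLaw.add {X Y : Ω → ℝ} {α σ₁ β₁ σ₂ β₂ : ℝ} (hX : IsStableLaw (P.map X) α σ₁ β₁ 0)
    (hY : IsStableLaw (P.map Y) α σ₂ β₂ 0) (hXY : IndepFun X Y P) :
    IsStableLaw (P.map fun ω => X ω + Y ω) α ((σ₁ ^ α + σ₂ ^ α) ^ (1 / α))
      ((σ₁ ^ α * β₁ + σ₂ ^ α * β₂) / (σ₁ ^ α + σ₂ ^ α)) 0 := by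
  -- Otherwise the pushforward would be the zero measure, which is not a probability measure.
  have hXm : AEMeasurable X P := by
    by_contra h
    have := hX.isProbabilityMeasure
    rw [Measure.map_of_not_aemeasurable h] at this
    exact IsProbabilityMeasure.ne_zero (0 : Measure ℝ) rfl
  have hYm : AEMeasurable Y P := by
    by_contra h
    have := hY.isProbabilityMeasure
    rw [Measure.map_of_not_aemeasurable h] at this
    exact IsProbabilityMeasure.ne_zero (0 : Measure ℝ) rfl
  have hα := hX.exponent_pos
  have p1 : 0 < σ₁ ^ α := Real.rpow_pos_of_pos hX.scale_pos α
  have p2 : 0 < σ₂ ^ α := Real.rpow_pos_of_pos hY.scale_pos α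
  refine ⟨hα, hX.exponent_le, by positivity, ?_, ?_,
    Measure.isProbabilityMeasure_map (hXm.add hYm), fun t => ?_⟩
  · rw [le_div_iff₀ (by positivity)]
    nlinarith [hX.skew_ge, hY.skew_ge]
  · rw [div_le_iff₀ (by positivity)]
    nlinarith [hX.skew_le, hY.skew_le]
  · rw [hXY.charFun_map_fun_add_eq_mul hXm hYm, Pi.mul_apply, hX.charFun_eq, hY.charFun_eq,
      stableCharFun, stableCharFun, stableCharFun, ← Complex.exp_add]
    congr 1
    have hs : 0 < (σ₁ ^ α + σ₂ ^ α) ^ (1 / α) := by positivity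
    rw [abs_mul, abs_mul, abs_mul, abs_of_pos hX.scale_pos, abs_of_pos hY.scale_pos,
      abs_of_pos hs, Real.mul_rpow hX.scale_pos.le (abs_nonneg _),
      Real.mul_rpow hY.scale_pos.le (abs_nonneg _), Real.mul_rpow hs.le (abs_nonneg _),
      ← Real.rpow_mul (by positivity), one_div_mul_cancel hα.ne', Real.rpow_one]
    have hne : ((σ₁ ^ α : ℝ) : ℂ) + ((σ₂ ^ α : ℝ) : ℂ) ≠ 0 := by
      rw [← Complex.ofReal_add]
      exact Complex.ofReal_ne_zero.2 (by positivity)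
    simp only [Complex.ofReal_mul, Complex.ofReal_add, Complex.ofReal_div, Complex.ofReal_zero]
    field_simp
    ring

end StableLaw

end CoexistingWSN

namespace CoexistingWSN

open Filter Topology Set

/-! ### Marking and thinning of Poisson processes. -/

section Marking

variable {Ω M : Type*} [MeasurableSpace Ω] [MeasurableSpace M] {P : Measure Ω}
  {x : ℕ → Ω → Plane} {m : ℕ → Ω → M} {lam : ℝ}

/-- The number of marked points in `B`, as a real number. -/
noncomputable def markedCount (x : ℕ → Ω → Plane) (m : ℕ → Ω → M) (B : Set (Plane × M))
    (ω : Ω) : ℝ :=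
  ∑' i, B.indicator (fun _ => (1 : ℝ)) (x i ω, m i ω)

theorem integrable_min_abs_one {X : Type*} [MeasurableSpace X] {ρ : Measure X} {f : X → ℝ}
    (hf : Integrable f ρ) : Integrable (fun p => min |f p| 1) ρ := by
  refine hf.mono (hf.1.norm.inf aestronglyMeasurable_const) (ae_of_all _ fun p => ?_)
  rw [Real.norm_of_nonneg (le_min (abs_nonneg _) zero_le_one)]
  exact min_le_left _ _

theorem integrable_indicator_one {X : Type*} [MeasurableSpace X] {ρ : Measure X} {B : Set X}
    (hB : MeasurableSet B) (hρ : ρ B < ∞) : Integrable (B.indicator fun _ => (1 : ℝ)) ρ :=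
  (integrable_indicator_iff hB).2 (integrableOn_const hρ.ne)

variable [IsProbabilityMeasure P]

theorem IsMarkedPoissonNetwork.aemeasurable_markedCount (net : IsMarkedPoissonNetwork x m lam P)
    {B : Set (Plane × M)} (hB : MeasurableSet B)
    (hfin : (intensity lam).prod (P.map (m 0)) B < ∞) : AEMeasurable (markedCount x m B) P :=
  net.aemeasurable_tsum (measurable_const.indicator hB)
    (integrable_min_abs_one (integrable_indicator_one hB hfin))

theorem IsMarkedPoissonNetwork.ae_summable_indicator (net : IsMarkedPoissonNetwork x m lam P)
    {B : Set (Plane × M)} (hB : MeasurableSet B)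
    (hfin : (intensity lam).prod (P.map (m 0)) B < ∞) :
    ∀ᵐ ω ∂P, Summable fun i => B.indicator (fun _ => (1 : ℝ)) (x i ω, m i ω) :=
  net.ae_summable (measurable_const.indicator hB)
    (integrable_min_abs_one (integrable_indicator_one hB hfin))

/-- By disjointness at most one indicator is nonzero at `p`. This additivity in the exponent is the
source of the independence of counts. -/
theorem one_sub_exp_sum_indicator {X : Type*} {n : ℕ} {B : Fin n → Set X}
    (hdisj : Pairwise (Function.onFun Disjoint B)) (t : Fin n → ℝ) (p : X) :
    1 - Complex.exp (Complex.I * (∑ k, t k * (B k).indicator (fun _ => (1 : ℝ)) p : ℝ)) =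
      ∑ k, (B k).indicator (fun _ => 1 - Complex.exp (Complex.I * t k)) p := by
  by_cases h : ∃ k, p ∈ B k
  · obtain ⟨k, hk⟩ := h
    have hne : ∀ j, j ≠ k → p ∉ B j := fun j hj hp =>
      Set.disjoint_left.1 (hdisj hj) hp hk
    rw [Finset.sum_eq_single k (fun j _ hj => by simp [hne j hj]) (by simp),
      Finset.sum_eq_single k (fun j _ hj => by simp [hne j hj]) (by simp)]
    simp [hk]
  · push Not at h
    simp [h]

variable {n : ℕ} {B : Fin n → Set (Plane × M)}

/-- The joint characteristic function of the numbers of marked points in disjoint sets. -/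
theorem IsMarkedPoissonNetwork.integral_exp_sum_markedCount
    (net : IsMarkedPoissonNetwork x m lam P) (hB : ∀ k, MeasurableSet (B k))
    (hfin : ∀ k, (intensity lam).prod (P.map (m 0)) (B k) < ∞)
    (hdisj : Pairwise (Function.onFun Disjoint B)) (t : Fin n → ℝ) :
    ∫ ω, Complex.exp (Complex.I * (∑ k, t k * markedCount x m (B k) ω : ℝ)) ∂P =
      ∏ k, Complex.exp (((intensity lam).prod (P.map (m 0))).real (B k) *
        (Complex.exp (Complex.I * t k) - 1)) := by
  have := net.isProbabilityMeasure_map_mark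
  let f : Plane × M → ℝ := fun p => ∑ k, t k * (B k).indicator (fun _ => (1 : ℝ)) p
  have hf : Measurable f := Finset.measurable_sum _ fun k _ =>
    (measurable_const.indicator (hB k)).const_mul (t k)
  have hfi : Integrable f ((intensity lam).prod (P.map (m 0))) :=
    integrable_finsetSum _ fun k _ => (integrable_indicator_one (hB k) (hfin k)).const_mul (t k)
  have hae : ∀ᵐ ω ∂P, ∑ k, t k * markedCount x m (B k) ω = ∑' i, f (x i ω, m i ω) := by
    filter_upwards [ae_all_iff.2 fun k => net.ae_summable_indicator (hB k) (hfin k)] with ω hω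
    simp only [f, markedCount]
    rw [Summable.tsum_finsetSum fun k _ => (hω k).mul_left (t k)]
    simp_rw [tsum_mul_left]
  rw [integral_congr_ae (g := fun ω => Complex.exp (Complex.I * (∑' i, f (x i ω, m i ω) : ℝ)))
    (hae.mono fun ω hω => by simp only [hω]), net.integral_exp_tsum hf (integrable_min_abs_one hfi),
    ← Complex.exp_sum]
  congr 1
  simp only [f]
  simp_rw [one_sub_exp_sum_indicator hdisj]
  rw [integral_finsetSum _ fun k _ => (integrable_indicator_iff (hB k)).2
    (integrableOn_const (hfin k).ne), ← Finset.sum_neg_distrib]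
  refine Finset.sum_congr rfl fun k _ => ?_
  rw [integral_indicator_const _ (hB k), Complex.real_smul]
  ring

theorem IsMarkedPoissonNetwork.integral_exp_markedCount (net : IsMarkedPoissonNetwork x m lam P)
    {B : Set (Plane × M)} (hB : MeasurableSet B)
    (hfin : (intensity lam).prod (P.map (m 0)) B < ∞) (t : ℝ) :
    ∫ ω, Complex.exp (Complex.I * (t * markedCount x m B ω : ℝ)) ∂P =
      Complex.exp (((intensity lam).prod (P.map (m 0))).real B *
        (Complex.exp (Complex.I * t) - 1)) := by
  have h := net.integral_exp_sum_markedCount (B := fun _ : Fin 1 => B) (fun _ => hB)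
    (fun _ => hfin) (fun i j hij => absurd (Subsingleton.elim i j) hij) fun _ => t
  simpa using h

theorem IsMarkedPoissonNetwork.charFun_markedCount (net : IsMarkedPoissonNetwork x m lam P)
    {B : Set (Plane × M)} (hB : MeasurableSet B)
    (hfin : (intensity lam).prod (P.map (m 0)) B < ∞) (t : ℝ) :
    charFun (P.map (markedCount x m B)) t =
      Complex.exp (((intensity lam).prod (P.map (m 0))).real B *
        (Complex.exp (Complex.I * t) - 1)) := by
  rw [← net.integral_exp_markedCount hB hfin, charFun_apply_real,
    integral_map (net.aemeasurable_markedCount hB hfin)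
      (Measurable.aestronglyMeasurable (by fun_prop))]
  congr with ω
  push_cast
  ring_nf

theorem IsMarkedPoissonNetwork.map_markedCount (net : IsMarkedPoissonNetwork x m lam P)
    {B : Set (Plane × M)} (hB : MeasurableSet B)
    (hfin : (intensity lam).prod (P.map (m 0)) B < ∞) :
    P.map (markedCount x m B) =
      (poissonMeasure ((intensity lam).prod (P.map (m 0)) B).toNNReal).map
        (fun k : ℕ => (k : ℝ)) := by
  have := Measure.isProbabilityMeasure_map (net.aemeasurable_markedCount hB hfin)
  have : IsProbabilityMeasure ((poissonMeasure
      ((intensity lam).prod (P.map (m 0)) B).toNNReal).map (fun k : ℕ => (k : ℝ))) :=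
    Measure.isProbabilityMeasure_map Measurable.of_discrete.aemeasurable
  refine Measure.ext_of_charFun (funext fun t => ?_)
  rw [net.charFun_markedCount hB hfin, charFun_map_cast_poissonMeasure, mul_comm Complex.I]
  rfl

/-- The joint characteristic function is the product of the marginal ones. -/
theorem IsMarkedPoissonNetwork.iIndepFun_markedCount (net : IsMarkedPoissonNetwork x m lam P)
    (hB : ∀ k, MeasurableSet (B k))
    (hfin : ∀ k, (intensity lam).prod (P.map (m 0)) (B k) < ∞)
    (hdisj : Pairwise (Function.onFun Disjoint B)) :
    iIndepFun (fun k => markedCount x m (B k)) P := by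
  have hm : ∀ k, AEMeasurable (markedCount x m (B k)) P := fun k =>
    net.aemeasurable_markedCount (hB k) (hfin k)
  refine (iIndepFun_iff_charFun_pi hm).2 fun t => ?_
  simp_rw [net.charFun_markedCount (hB _) (hfin _)]
  rw [← net.integral_exp_sum_markedCount hB hfin hdisj, charFun_apply, integral_map
    (φ := fun ω => WithLp.toLp 2 fun k => markedCount x m (B k) ω)
    ((by fun_prop : Measurable (WithLp.toLp 2 : (Fin n → ℝ) → PiLp 2 fun _ => ℝ)).comp_aemeasurable
      (aemeasurable_pi_lambda _ hm)) (Measurable.aestronglyMeasurable (by fun_prop))]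
  congr with ω
  rw [PiLp.inner_apply, mul_comm]
  simp [mul_comm]

theorem IsMarkedPoissonNetwork.pointProcess_ae_eq (net : IsMarkedPoissonNetwork x m lam P)
    {B : Set (Plane × M)} (hB : MeasurableSet B)
    (hfin : (intensity lam).prod (P.map (m 0)) B < ∞) :
    (fun ω => pointProcess (fun i ω => (x i ω, m i ω)) ω B) =ᵐ[P]
      fun ω => ENNReal.ofReal (markedCount x m B ω) := by
  filter_upwards [net.ae_summable_indicator hB hfin] with ω hω
  rw [pointProcess_apply _ _ hB, markedCount, ENNReal.ofReal_tsum_of_nonneg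
    (fun i => indicator_nonneg (fun _ _ => zero_le_one) _) hω]
  congr with i
  by_cases h : (x i ω, m i ω) ∈ B <;> simp [h]

/-- The marking theorem: the marked points form a Poisson point process. -/
theorem IsMarkedPoissonNetwork.isPoissonPointProcess_prod
    (net : IsMarkedPoissonNetwork x m lam P) :
    IsPoissonPointProcess (pointProcess fun i ω => (x i ω, m i ω))
      ((intensity lam).prod (P.map (m 0))) P where
  count_law B hB hfin := by
    rw [Measure.map_congr (net.pointProcess_ae_eq hB hfin),
      ← Function.comp_def ENNReal.ofReal (markedCount x m B),
      ← AEMeasurable.map_map_of_aemeasurable ENNReal.measurable_ofReal.aemeasurable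
        (net.aemeasurable_markedCount hB hfin), net.map_markedCount hB hfin,
      Measure.map_map ENNReal.measurable_ofReal Measurable.of_discrete]
    congr 1
    funext k
    simp
  count_indep n B hB hfin hdisj :=
    ((net.iIndepFun_markedCount hB hfin hdisj).comp (fun _ => ENNReal.ofReal)
      fun _ => ENNReal.measurable_ofReal).congr
      fun k => (net.pointProcess_ae_eq (hB k) (hfin k)).symm

theorem intensity_mul_measureReal (hlam : 0 ≤ lam) {Q : Measure M} [IsProbabilityMeasure Q]
    {D : Set M} {q : ℝ} (hq : Q.real D = q) (A : Set Plane) :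
    (intensity lam).prod Q (A ×ˢ D) = intensity (lam * q) A := by
  rw [Measure.prod_prod, intensity, intensity, Measure.smul_apply, Measure.smul_apply,
    smul_eq_mul, smul_eq_mul, ENNReal.ofReal_mul hlam, ← hq, ofReal_measureReal]
  ring

/-- The thinning theorem: the nodes without an error form a Poisson point process. -/
theorem IsMarkedPoissonNetwork.isHomogeneousPPP_transmittingNodes
    (net : IsMarkedPoissonNetwork x m lam P) (hlam : 0 ≤ lam) {e : M → Bool} (he : Measurable e)
    {q : ℝ} (hq : (P.map (m 0)).real (e ⁻¹' {false}) = q) :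
    IsHomogeneousPPP (transmittingNodes x fun i ω => e (m i ω)) (lam * q) P := by
  have := net.isProbabilityMeasure_map_mark
  have hD : MeasurableSet (e ⁻¹' {false}) := he (measurableSet_singleton _)
  -- Transmitting nodes in `A` are the marked points in `A ×ˢ (e ⁻¹' {false})`, a set of intensity
  -- `lam * q` times the area of `A`.
  have hval : ∀ {A : Set Plane}, MeasurableSet A →
      (fun ω => transmittingNodes x (fun i ω => e (m i ω)) ω A) =
        fun ω => pointProcess (fun i ω => (x i ω, m i ω)) ω (A ×ˢ (e ⁻¹' {false})) := by
    intro A hA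
    funext ω
    rw [pointProcess_apply _ _ (hA.prod hD), transmittingNodes, Measure.sum_apply _ hA]
    congr with i
    by_cases h : e (m i ω) = true
    · simp [h]
    · by_cases hx : x i ω ∈ A <;> simp [h, hx, Measure.dirac_apply' _ hA]
  have hΛ := fun A => intensity_mul_measureReal hlam hq A
  have hmark := net.isPoissonPointProcess_prod
  refine ⟨fun A hA hfin => ?_, fun n A hA hfin hdisj => ?_⟩
  · rw [hval hA, hmark.count_law _ (hA.prod hD) (by rw [hΛ]; exact hfin), hΛ]
    rfl
  · have h : (fun (i : Fin n) ω => transmittingNodes x (fun i ω => e (m i ω)) ω (A i)) =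
        fun i ω => pointProcess (fun i ω => (x i ω, m i ω)) ω (A i ×ˢ (e ⁻¹' {false})) :=
      funext fun k => hval (hA k)
    rw [h]
    refine hmark.count_indep n _ (fun k => (hA k).prod hD) (fun k => ?_) fun i j hij => ?_
    · rw [hΛ]
      exact hfin k
    · exact Set.Disjoint.set_prod_left (hdisj hij) _ _

end Marking

end CoexistingWSN

namespace CoexistingWSN

open Filter Topology Set

/-! ### Moments of the emissions and independence of the two signals. -/

theorem aggregate_eq_zero {Ω : Type*} {δ : ℝ} {x : ℕ → Ω → Plane} {a : ℕ → Ω → ℝ} (ha : ∀ i ω, a i ω = 0) (ω : Ω) :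
    aggregate δ x a ω = 0 := by
  simp [aggregate, contribution, ha]

theorem emissionErr_H0 {Ω : Type*} (h : ℕ → Ω → ℝ) (err : ℕ → Ω → Bool) (M : ℝ) (i : ℕ) (ω : Ω) :
    emissionErr h err M Hypothesis.H0 i ω = 0 := by
  simp [emissionErr, decisionErr, decision]

theorem emission_H0 {Ω : Type*} (h : ℕ → Ω → ℝ) (M : ℝ) (i : ℕ) (ω : Ω) :
    emission h M Hypothesis.H0 i ω = 0 := by
  simp [emission, decision]

section Emissions

variable {Ω M M' : Type*} [MeasurableSpace Ω] [MeasurableSpace M] [MeasurableSpace M']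
  {P : Measure Ω} {δ : ℝ}

/-- The signals received from two independent networks are independent. -/
theorem IsMarkedPoissonNetwork.indepFun_aggregate [IsProbabilityMeasure P]
    {x y : ℕ → Ω → Plane} {m : ℕ → Ω → M} {m' : ℕ → Ω → M'} {lam lam' : ℝ}
    (net : IsMarkedPoissonNetwork x m lam P) (net' : IsMarkedPoissonNetwork y m' lam' P)
    (hind : IndepFun (fun ω => (fun i => x i ω, fun i => m i ω))
      (fun ω => (fun i => y i ω, fun i => m' i ω)) P) (hδ : 2 < δ) (hlam : 0 ≤ lam)
    (hlam' : 0 ≤ lam') {a : M → ℝ} {a' : M' → ℝ} (ha : Measurable a) (ha' : Measurable a')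
    (hi : Integrable (fun b => |a b| ^ (2 / δ)) (P.map (m 0)))
    (hi' : Integrable (fun b => |a' b| ^ (2 / δ)) (P.map (m' 0))) :
    IndepFun (aggregate δ x fun i ω => a (m i ω)) (aggregate δ y fun i ω => a' (m' i ω)) P := by
  have := net.isProbabilityMeasure_map_mark
  have := net'.isProbabilityMeasure_map_mark
  have h := hind.comp (measurable_sumFunctional (measurable_gain ha δ))
    (measurable_sumFunctional (measurable_gain ha' δ))
  exact h.congr
    (net.ae_eq_sumFunctional (measurable_gain ha δ) (integrable_min_gain hδ hlam ha hi)).symm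
    (net'.ae_eq_sumFunctional (measurable_gain ha' δ) (integrable_min_gain hδ hlam' ha' hi')).symm

theorem IsMarkedPoissonNetwork.ae_summable_contribution [IsProbabilityMeasure P]
    {x : ℕ → Ω → Plane} {m : ℕ → Ω → M} {lam : ℝ}
    (net : IsMarkedPoissonNetwork x m lam P) (hδ : 2 < δ) (hlam : 0 ≤ lam)
    {a : M → ℝ} (ha : Measurable a) (hi : Integrable (fun b => |a b| ^ (2 / δ)) (P.map (m 0))) :
    ∀ᵐ ω ∂P, Summable fun i => contribution δ x (fun i ω => a (m i ω)) i ω := by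
  have := net.isProbabilityMeasure_map_mark
  have h := net.ae_summable (measurable_gain ha δ) (integrable_min_gain hδ hlam ha hi)
  exact h

theorem sign_mul_abs_rpow_of_nonneg {a p : ℝ} (ha : 0 ≤ a) (hp : p ≠ 0) :
    Real.sign a * |a| ^ p = |a| ^ p := by
  rcases ha.eq_or_lt with rfl | h
  · simp [Real.zero_rpow hp]
  · rw [Real.sign_of_pos h, one_mul]

theorem abs_sq_mul_rpow (u : ℝ) {c : ℝ} (hc : 0 ≤ c) (p : ℝ) :
    |u ^ 2 * c| ^ p = |u| ^ (2 * p) * c ^ p := by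
  rw [abs_mul, abs_of_nonneg hc, Real.mul_rpow (abs_nonneg _) hc, abs_pow,
    Real.rpow_mul (abs_nonneg _)]
  norm_cast

/-- For `0 ≤ p ≤ 1` and `s ≥ 0` one has `s ^ p ≤ 1 + s`, applied to `s = h ω ^ 2`. -/
theorem integrable_abs_rpow_of_integrable_sq [IsFiniteMeasure P] {h : Ω → ℝ} (hm : Measurable h)
    (hi : Integrable (fun ω => h ω ^ 2) P) {p : ℝ} (hp0 : 0 ≤ p) (hp1 : p ≤ 1) :
    Integrable (fun ω => |h ω| ^ (2 * p)) P := by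
  refine ((integrable_const (1 : ℝ)).add hi).mono'
    (by fun_prop : Measurable fun ω => |h ω| ^ (2 * p)).aestronglyMeasurable
    (ae_of_all _ fun ω => ?_)
  rw [Real.norm_of_nonneg (by positivity), Real.rpow_mul (abs_nonneg _), Real.rpow_two, sq_abs]
  simp only [Pi.add_apply]
  have h2 := sq_nonneg (h ω)
  rcases le_total (h ω ^ 2) 1 with h1 | h1
  · exact (Real.rpow_le_one h2 h1 hp0).trans (by linarith)
  · refine (Real.rpow_le_rpow_of_exponent_le h1 hp1).trans ?_
    rw [Real.rpow_one]
    linarith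

theorem integral_abs_rpow_pos {h : Ω → ℝ} {p : ℝ} (hp : 0 < p)
    (hi : Integrable (fun ω => |h ω| ^ p) P) (hsq : ∫ ω, h ω ^ 2 ∂P ≠ 0) :
    0 < ∫ ω, |h ω| ^ p ∂P := by
  refine lt_of_le_of_ne (integral_nonneg fun ω => by positivity) fun h0 => hsq ?_
  have h1 := (integral_eq_zero_iff_of_nonneg (fun ω => by positivity) hi).1 h0.symm
  refine integral_eq_zero_of_ae ?_
  filter_upwards [h1] with ω hω
  have : |h ω| = 0 := (Real.rpow_eq_zero (abs_nonneg _) hp.ne').1 hω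
  simp [abs_eq_zero.1 this]

/-- A symmetric factor, independent of the others, cancels the signed moment. -/
theorem integral_sign_mul_abs_rpow_eq_zero [IsProbabilityMeasure P] {u v w : Ω → ℝ}
    (hv : Measurable v) (hw : Measurable w)
    (hsymm : IdentDistrib u (fun ω => -u ω) P P) (hind : IndepFun u (fun ω => (v ω, w ω)) P)
    (p : ℝ) : ∫ ω, Real.sign (u ω * v ω * w ω) * |u ω * v ω * w ω| ^ p ∂P = 0 := by
  have hneg : IndepFun (fun ω => -u ω) (fun ω => (v ω, w ω)) P :=
    hind.comp measurable_neg measurable_id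
  have hid := hsymm.prodMk (IdentDistrib.refl (hv.prodMk hw).aemeasurable) hind hneg
  -- `(u, v, w)` and `(-u, v, w)` have the same law and the integrand is odd in `u`, so the integral
  -- equals its own negative.
  have hφ : Measurable fun q : ℝ × ℝ × ℝ =>
      Real.sign (q.1 * q.2.1 * q.2.2) * |q.1 * q.2.1 * q.2.2| ^ p :=
    (measurable_sign.comp (by fun_prop)).mul (by fun_prop)
  have h := (hid.comp hφ).integral_eq
  simp only [Function.comp_def, neg_mul, Real.sign_neg, abs_neg] at h
  rw [integral_neg] at h
  linarith

theorem rpow_one_div_spec {c α : ℝ} (hc : 0 < c) (hα : 0 < α) :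
    0 < c ^ (1 / α) ∧ (c ^ (1 / α)) ^ α = c :=
  ⟨by positivity, by rw [← Real.rpow_mul hc.le, one_div_mul_cancel hα.ne', Real.rpow_one]⟩

theorem div_add_mem_Ioo {a b : ℝ} (ha : 0 < a) (hb : 0 < b) : a / (a + b) ∈ Ioo (0 : ℝ) 1 :=
  ⟨by positivity, (div_lt_one (by positivity)).2 (by linarith)⟩

/-- The emission of a desired sensor, as a function of its mark. -/
def markEmission (M : ℝ) (b : ℝ × Bool) : ℝ := b.1 ^ 2 * M

/-- The emission of a desired sensor that may be in error, as a function of its mark. -/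
def markEmissionErr (M : ℝ) (b : ℝ × Bool) : ℝ := b.1 ^ 2 * if b.2 then 0 else M

/-- The effective emission of an interfering node, as a function of its mark. -/
def markInterferer (b : ℝ × ℝ × ℝ) : ℝ := b.1 * b.2.1 * b.2.2

theorem measurable_markEmission (M : ℝ) : Measurable (markEmission M) :=
  (measurable_fst.pow_const 2).mul_const M

theorem measurable_markEmissionErr (M : ℝ) : Measurable (markEmissionErr M) :=
  (measurable_fst.pow_const 2).mul
    ((Measurable.of_discrete (f := fun b : Bool => if b then (0 : ℝ) else M)).comp measurable_snd)

theorem measurable_markInterferer : Measurable markInterferer :=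
  (measurable_fst.mul measurable_snd.fst).mul measurable_snd.snd

theorem markEmission_nonneg {M : ℝ} (hM : 0 ≤ M) (b : ℝ × Bool) : 0 ≤ markEmission M b :=
  mul_nonneg (sq_nonneg _) hM

theorem markEmissionErr_nonneg {M : ℝ} (hM : 0 ≤ M) (b : ℝ × Bool) :
    0 ≤ markEmissionErr M b :=
  mul_nonneg (sq_nonneg _) (by split_ifs; exacts [le_rfl, hM])

theorem measurable_abs_rpow {X : Type*} [MeasurableSpace X] {f : X → ℝ} (hf : Measurable f)
    (p : ℝ) : Measurable fun b => |f b| ^ p := by fun_prop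

variable {h : Ω → ℝ} {e : Ω → Bool} {p c : ℝ}

theorem integrable_abs_markEmission_rpow (hh : Measurable h) (he : Measurable e) (hc : 0 ≤ c)
    (hmom : Integrable (fun ω => |h ω| ^ (2 * p)) P) :
    Integrable (fun b => |markEmission c b| ^ p) (P.map fun ω => (h ω, e ω)) := by
  rw [integrable_map_measure
    (measurable_abs_rpow (measurable_markEmission c) p).aestronglyMeasurable
    (hh.prodMk he).aemeasurable]
  simp only [Function.comp_def, markEmission, abs_sq_mul_rpow _ hc]
  exact hmom.mul_const _

theorem integrable_abs_markEmissionErr_rpow (hh : Measurable h) (he : Measurable e) (hc : 0 ≤ c)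
    (hp : 0 ≤ p) (hmom : Integrable (fun ω => |h ω| ^ (2 * p)) P) :
    Integrable (fun b => |markEmissionErr c b| ^ p) (P.map fun ω => (h ω, e ω)) := by
  refine (integrable_abs_markEmission_rpow hh he hc hmom).mono'
    (measurable_abs_rpow (measurable_markEmissionErr c) p).aestronglyMeasurable
    (ae_of_all _ fun b => ?_)
  rw [Real.norm_of_nonneg (by positivity), abs_of_nonneg (markEmission_nonneg hc b),
    abs_of_nonneg (markEmissionErr_nonneg hc b)]
  refine Real.rpow_le_rpow (markEmissionErr_nonneg hc b)
    (mul_le_mul_of_nonneg_left ?_ (sq_nonneg _)) hp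
  split_ifs
  exacts [hc, le_rfl]

theorem integral_abs_markEmission_rpow (hh : Measurable h) (he : Measurable e) (hc : 0 ≤ c) :
    ∫ b, |markEmission c b| ^ p ∂(P.map fun ω => (h ω, e ω)) =
      c ^ p * ∫ ω, |h ω| ^ (2 * p) ∂P := by
  rw [integral_map (hh.prodMk he).aemeasurable
    (measurable_abs_rpow (measurable_markEmission c) p).aestronglyMeasurable]
  simp only [markEmission, abs_sq_mul_rpow _ hc]
  rw [integral_mul_const, mul_comm]

/-- The emission splits into a function of `h` times an indicator of no error, so independence pulls
out the probability of transmission. -/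
theorem integral_abs_markEmissionErr_rpow (hh : Measurable h) (he : Measurable e) (hc : 0 ≤ c)
    (hp : p ≠ 0) (hind : IndepFun h e P) :
    ∫ b, |markEmissionErr c b| ^ p ∂(P.map fun ω => (h ω, e ω)) =
      P.real {ω | e ω = false} * (c ^ p * ∫ ω, |h ω| ^ (2 * p) ∂P) := by
  rw [integral_map (hh.prodMk he).aemeasurable
    (measurable_abs_rpow (measurable_markEmissionErr c) p).aestronglyMeasurable]
  have hpow : ∀ ω, |markEmissionErr c (h ω, e ω)| ^ p =
      |h ω| ^ (2 * p) * (if e ω then 0 else c ^ p) := fun ω => by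
    rw [markEmissionErr, abs_sq_mul_rpow _ (by split_ifs; exacts [le_rfl, hc])]
    split_ifs <;> simp [Real.zero_rpow hp]
  simp_rw [hpow]
  have hmul := hind.integral_fun_comp_mul_comp (f := fun u => |u| ^ (2 * p))
    (g := fun b : Bool => if b then (0 : ℝ) else c ^ p) hh.aemeasurable he.aemeasurable
    (Measurable.aestronglyMeasurable (by fun_prop)) Measurable.of_discrete.aestronglyMeasurable
  have hset : ∀ ω, (if e ω then (0 : ℝ) else c ^ p) =
      {ω | e ω = false}.indicator (fun _ => c ^ p) ω := fun ω => by
    by_cases h : e ω = true <;> simp [h]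
  have hms : MeasurableSet {ω | e ω = false} := he (measurableSet_singleton false)
  rw [hmul]
  simp_rw [hset]
  rw [integral_indicator_const _ hms, smul_eq_mul]
  ring

theorem measureReal_eq_false [IsProbabilityMeasure P] (he : Measurable e) :
    P.real {ω | e ω = false} = 1 - P.real {ω | e ω = true} := by
  have hms : MeasurableSet {ω | e ω = true} := he (measurableSet_singleton true)
  rw [← probReal_compl_eq_one_sub hms]
  congr 1
  ext ω
  simp

theorem integral_sign_mul_abs_of_nonneg {X : Type*} [MeasurableSpace X] {μ : Measure X}
    {f : X → ℝ} (hf : ∀ b, 0 ≤ f b) (hp : p ≠ 0) :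
    ∫ b, Real.sign (f b) * |f b| ^ p ∂μ = 1 * ∫ b, |f b| ^ p ∂μ := by
  rw [one_mul]
  simp_rw [fun b => sign_mul_abs_rpow_of_nonneg (hf b) hp]

end Emissions

end CoexistingWSN

/-! ### Assembly of the detection problem. -/

theorem mainTheorem1 {Ω : Type*} [MeasurableSpace Ω] (P : Measure Ω) [IsProbabilityMeasure P]
    -- path-loss exponent, characteristic exponent, densities, decision level, error probability
    (δ α lamD lamI M pe : ℝ) (hδ : 2 < δ) (hα : α = 2 / δ)
    (hlamD : 0 < lamD) (hlamI : 0 < lamI) (hM : 0 < M) (hpe : pe < 1)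
    -- desired network: positions, channel coefficients, local detection errors
    (x : ℕ → Ω → Plane) (h : ℕ → Ω → ℝ) (err : ℕ → Ω → Bool)
    (desired : IsMarkedPoissonNetwork x (fun i ω => (h i ω, err i ω)) lamD P)
    (h_sq : ∫ ω, h 0 ω ^ 2 ∂P = 1)
    (h_indep_err : IndepFun (h 0) (err 0) P)
    (err_prob : P.real {ω | err 0 ω = true} = pe)
    -- interfering network: positions, channels to the two fusion centers, emissions
    (y : ℕ → Ω → Plane) (hI g w : ℕ → Ω → ℝ)
    (interfering : IsMarkedPoissonNetwork y (fun i ω => (hI i ω, g i ω, w i ω)) lamI P)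
    (hI_symm : IdentDistrib (hI 0) (fun ω => -hI 0 ω) P P)
    (hI_indep : IndepFun (hI 0) (fun ω => (g 0 ω, w 0 ω)) P)
    (int_moment : Integrable (fun ω => |interferer hI g w 0 ω| ^ α) P)
    (pos_moment : 0 < ∫ ω, |interferer hI g w 0 ω| ^ α ∂P)
    -- the two networks are independent
    (networks_indep : IndepFun
      (fun ω => (fun i => x i ω, fun i => (h i ω, err i ω)))
      (fun ω => (fun i => y i ω, fun i => (hI i ω, g i ω, w i ω))) P)
    -- signal, interference and observation, without and with local errors
    (W : Ω → ℝ) (hW : W = aggregate δ y (interferer hI g w))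
    (S : Ω → ℝ) (hS : S = aggregate δ x (emission h M Hypothesis.H1))
    (Se : Ω → ℝ) (hSe : Se = aggregate δ x (emissionErr h err M Hypothesis.H1))
    (Y : Hypothesis → Ω → ℝ)
    (hY : ∀ k ω, Y k ω = aggregate δ x (emission h M k) ω + W ω)
    (Ye : Hypothesis → Ω → ℝ)
    (hYe : ∀ k ω, Ye k ω = aggregate δ x (emissionErr h err M k) ω + W ω) :
    -- the series converge absolutely almost surely
    (∀ᵐ ω ∂P, Summable fun i => contribution δ x (emission h M Hypothesis.H1) i ω) ∧
    (∀ᵐ ω ∂P, Summable fun i => contribution δ x (emissionErr h err M Hypothesis.H1) i ω) ∧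
    (∀ᵐ ω ∂P, Summable fun i => contribution δ y (interferer hI g w) i ω) ∧
    ∃ σS σW σSe : ℝ,
      σS ^ α = lamD * (Real.pi / 2) * (stableConst α)⁻¹ *
        (M ^ α * ∫ ω, |h 0 ω| ^ (2 * α) ∂P) ∧
      σW ^ α = lamI * (Real.pi / 2) * (stableConst α)⁻¹ *
        ∫ ω, |interferer hI g w 0 ω| ^ α ∂P ∧
      -- laws of the signal and of the interference
      IsStableLaw (P.map S) α σS 1 0 ∧
      IsStableLaw (P.map W) α σW 0 0 ∧
      -- the hypothesis test
      (Y Hypothesis.H1 = fun ω => S ω + W ω) ∧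
      Y Hypothesis.H0 = W ∧
      IsStableLaw (P.map (Y Hypothesis.H1)) α ((σS ^ α + σW ^ α) ^ (1 / α))
        (σS ^ α / (σS ^ α + σW ^ α)) 0 ∧
      IsStableLaw (P.map (Y Hypothesis.H0)) α σW 0 0 ∧
      σS ^ α / (σS ^ α + σW ^ α) ∈ Set.Ioo (0 : ℝ) 1 ∧
      -- with local errors: thinned network, same test with a changed scale of the signal
      IsHomogeneousPPP (transmittingNodes x err) (lamD * (1 - pe)) P ∧
      σSe ^ α = lamD * (1 - pe) * (Real.pi / 2) * (stableConst α)⁻¹ *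
        (M ^ α * ∫ ω, |h 0 ω| ^ (2 * α) ∂P) ∧
      IsStableLaw (P.map Se) α σSe 1 0 ∧
      (Ye Hypothesis.H1 = fun ω => Se ω + W ω) ∧
      Ye Hypothesis.H0 = W ∧
      IsStableLaw (P.map (Ye Hypothesis.H1)) α ((σSe ^ α + σW ^ α) ^ (1 / α))
        (σSe ^ α / (σSe ^ α + σW ^ α)) 0 ∧
      IsStableLaw (P.map (Ye Hypothesis.H0)) α σW 0 0 ∧
      σSe ^ α / (σSe ^ α + σW ^ α) ∈ Set.Ioo (0 : ℝ) 1 ∧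
      (0 < pe → σSe ^ α < σS ^ α) := by
  subst hα hW hS hSe
  have h0 := two_div_pos hδ
  have h1 := two_div_lt_one hδ
  have hC := pi_div_two_mul_inv_stableConst_pos h0 h1
  have hhm : Measurable (h 0) := (desired.measurable_mark 0).fst
  have hem : Measurable (err 0) := (desired.measurable_mark 0).snd
  have hgm : Measurable (g 0) := (interfering.measurable_mark 0).snd.fst
  have hwm : Measurable (w 0) := (interfering.measurable_mark 0).snd.snd
  -- A non-integrable function has integral 0 by convention, so the value 1 forces integrability.
  have hsq : Integrable (fun ω => h 0 ω ^ 2) P := by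
    by_contra hn
    rw [integral_undef hn] at h_sq
    exact zero_ne_one h_sq
  have hmom := integrable_abs_rpow_of_integrable_sq hhm hsq h0.le h1.le
  have hmompos := integral_abs_rpow_pos (by positivity) hmom (by rw [h_sq]; exact one_ne_zero)
  have ham := measurable_markEmission M
  have haem := measurable_markEmissionErr M
  have haIm := measurable_markInterferer
  have hmarkI := (interfering.measurable_mark 0).aemeasurable (μ := P)
  have hai := integrable_abs_markEmission_rpow hhm hem hM.le hmom
  have haei := integrable_abs_markEmissionErr_rpow hhm hem hM.le h0.le hmom
  have hA := integral_abs_markEmission_rpow (P := P) (p := 2 / δ) hhm hem hM.le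
  have herr := measureReal_eq_false (P := P) hem
  rw [err_prob] at herr
  have hAe := integral_abs_markEmissionErr_rpow hhm hem hM.le h0.ne' h_indep_err
  rw [herr] at hAe
  have haIi : Integrable (fun b => |markInterferer b| ^ (2 / δ))
      (P.map fun ω => (hI 0 ω, g 0 ω, w 0 ω)) := by
    rw [integrable_map_measure (measurable_abs_rpow haIm _).aestronglyMeasurable hmarkI]
    exact int_moment
  have hAI : ∫ b, |markInterferer b| ^ (2 / δ) ∂(P.map fun ω => (hI 0 ω, g 0 ω, w 0 ω)) =
      ∫ ω, |interferer hI g w 0 ω| ^ (2 / δ) ∂P :=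
    integral_map hmarkI (measurable_abs_rpow haIm _).aestronglyMeasurable
  have hsgnI : ∫ b, Real.sign (markInterferer b) * |markInterferer b| ^ (2 / δ)
      ∂(P.map fun ω => (hI 0 ω, g 0 ω, w 0 ω)) = 0 := by
    have hm : Measurable fun b => Real.sign (markInterferer b) * |markInterferer b| ^ (2 / δ) :=
      (measurable_sign.comp haIm).mul (measurable_abs_rpow haIm _)
    rw [integral_map hmarkI hm.aestronglyMeasurable]
    exact integral_sign_mul_abs_rpow_eq_zero hgm hwm hI_symm hI_indep _
  -- the scales
  have hmM : 0 < M ^ (2 / δ) * ∫ ω, |h 0 ω| ^ (2 * (2 / δ)) ∂P :=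
    mul_pos (Real.rpow_pos_of_pos hM _) hmompos
  have hpe' : 0 < 1 - pe := by linarith
  have hscale : ∀ {l A : ℝ}, 0 < l → 0 < A →
      0 < l * (Real.pi / 2) * (stableConst (2 / δ))⁻¹ * A := fun {l A} hl hA => by
    rw [mul_assoc l]
    positivity
  obtain ⟨hσS, hσS'⟩ := rpow_one_div_spec (hscale hlamD hmM) h0
  obtain ⟨hσW, hσW'⟩ := rpow_one_div_spec (hscale hlamI pos_moment) h0
  obtain ⟨hσe, hσe'⟩ := rpow_one_div_spec (hscale (mul_pos hlamD hpe') hmM) h0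
  -- the laws
  have lawS := desired.isStableLaw_aggregate hδ hlamD.le ham hai (by norm_num)
    (integral_sign_mul_abs_of_nonneg (markEmission_nonneg hM.le) h0.ne') hσS (by rw [hσS', hA])
  -- The full network of density `lamD` is kept, silent sensors emitting 0; the factor `1 - pe`
  -- enters through the moment and is then absorbed into the density.
  have lawSe := desired.isStableLaw_aggregate hδ hlamD.le haem haei (by norm_num)
    (integral_sign_mul_abs_of_nonneg (markEmissionErr_nonneg hM.le) h0.ne') hσe (by
      rw [hσe', hAe]
      ring)
  have lawW := interfering.isStableLaw_aggregate hδ hlamI.le haIm haIi (β := 0) (by norm_num)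
    (by rw [hsgnI, zero_mul]) hσW (by rw [hσW', hAI])
  have indS := desired.indepFun_aggregate interfering networks_indep hδ hlamD.le hlamI.le ham haIm
    hai haIi
  have indSe := desired.indepFun_aggregate interfering networks_indep hδ hlamD.le hlamI.le haem
    haIm haei haIi
  have sumS := desired.ae_summable_contribution hδ hlamD.le ham hai
  have sumSe := desired.ae_summable_contribution hδ hlamD.le haem haei
  have sumW := interfering.ae_summable_contribution hδ hlamI.le haIm haIi
  have thin := desired.isHomogeneousPPP_transmittingNodes hlamD.le measurable_snd (q := 1 - pe) (by
    rw [map_measureReal_apply (desired.measurable_mark 0)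
      (measurable_snd (measurableSet_singleton false))]
    exact herr)
  have hY0 : Y Hypothesis.H0 = aggregate δ y (interferer hI g w) := funext fun ω => by
    rw [hY, aggregate_eq_zero (emission_H0 h M), zero_add]
  have hYe0 : Ye Hypothesis.H0 = aggregate δ y (interferer hI g w) := funext fun ω => by
    rw [hYe, aggregate_eq_zero (emissionErr_H0 h err M), zero_add]
  have hY1 := funext (hY Hypothesis.H1)
  have hYe1 := funext (hYe Hypothesis.H1)
  have lawY := lawS.add lawW indS
  have lawYe := lawSe.add lawW indSe
  -- With skews 1 and 0 the weighted mean of skews reduces to the signal's share of the total scale.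
  simp only [mul_one, mul_zero, add_zero] at lawY lawYe
  refine ⟨sumS, sumSe, sumW, _, _, _, hσS', hσW', lawS, lawW,
    hY1, hY0, by rw [hY1]; exact lawY, by rw [hY0]; exact lawW,
    div_add_mem_Ioo (Real.rpow_pos_of_pos hσS _) (Real.rpow_pos_of_pos hσW _), thin, hσe', lawSe,
    hYe1, hYe0, by rw [hYe1]; exact lawYe, by rw [hYe0]; exact lawW,
    div_add_mem_Ioo (Real.rpow_pos_of_pos hσe _) (Real.rpow_pos_of_pos hσW _), fun hpe0 => ?_⟩
  rw [hσS', hσe', mul_assoc _ (Real.pi / 2), mul_assoc _ (Real.pi / 2)]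
  have h3 : lamD * (1 - pe) < lamD := by nlinarith
  exact mul_lt_mul_of_pos_right (mul_lt_mul_of_pos_right h3 hC) hmM
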